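/- Let $n\ge 0$ and equip real projective space $\mathbb{RP}^n$ with the round Riemannian distance (the angle between lines in $\mathbb R^{n+1}$). A set $\Omega\subset\mathbb{RP}^n$ is \emph{convex} if any two of its points are joined by a segment of a projective line contained in $\Omega$; it is here called \emph{properly convex} if, in addition, $\operatorname{cl}\Omega$ contains no projective line ($\Omega$ is not required to be open). It has dimension $n$ if its interior is non-empty. Sets $A_k$ converge to $A$ in the \emph{Hausdorff boundary topology} if the Hausdorff distance from $A_k$ to $A$ and the Hausdorff distance from $\operatorname{Fr}A_k$ to $\operatorname{Fr}A$ both tend to $0$, where $\operatorname{Fr}A=\operatorname{cl}A\setminus\operatorname{int}A$. For a group $G$, give $\operatorname{Hom}(G,\operatorname{PGL}(n+1,\mathbb R))$ the topology of pointwise convergence. The character variety is the (real geometric invariant theory) quotient $$\mathcal X(G)=\operatorname{Hom}(G,\operatorname{PGL}(n+1,\mathbb R))/\!/\operatorname{PGL}(n+1,\mathbb R)$$ by the equivalence relation generated by identifying two representations whenever the closures of their conjugacy classes intersect, and $\chi:\operatorname{Hom}(G,\operatorname{PGL}(n+1,\mathbb R))\to\mathcal X(G)$ is the projection. \textbf{Proposition.}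 Let $G$ be a finitely generated group and let $\rho_k:G\to\operatorname{PGL}(n+1,\mathbb R)$, $k\in\mathbb N$, be representations such that $\rho_k(G)$ preserves a properly convex set $\Omega_k\subset\mathbb{RP}^n$ with $\dim\Omega_k=n$. Suppose $\lim_k\rho_k=\rho_\infty$ in $\operatorname{Hom}(G,\operatorname{PGL}(n+1,\mathbb R))$. Then, after passing to a subsequence, there are $\beta_k\in\operatorname{PGL}(n+1,\mathbb R)$, a representation $\sigma\in\operatorname{Hom}(G,\operatorname{PGL}(n+1,\mathbb R))$ and an open properly convex set $\Omega\subset\mathbb{RP}^n$ with $\dim\Omega=n$ such that $$\lim_k\beta_k\rho_k\beta_k^{-1}=\sigma,$$ $\beta_k(\Omega_k)$ converges to $\Omega$ in the Hausdorff boundary topology, $\sigma(G)$ preserves $\Omega$, and $\chi(\sigma)=\chi(\rho_\infty)$. -/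

import Mathlib

open Filter Topology
open scoped Pointwise LinearAlgebra.Projectivization

noncomputable section

/-- Real projective space of dimension `n`: the lines through the origin in `ℝⁿ⁺¹`. -/
abbrev RPn (n : ℕ) : Type := ℙ ℝ (Fin (n + 1) → ℝ)

/-- The group `PGL(n + 1, ℝ)`, acting on `RPn n` through Mathlib's action. -/
abbrev PGLR (n : ℕ) : Type := Matrix.ProjGenLinGroup (Fin (n + 1)) ℝ

/-- The quotient topology on `PGL(n + 1, ℝ) = GL(n + 1, ℝ) / center`. -/
instance PGLR.instTopologicalSpace (n : ℕ) : TopologicalSpace (PGLR n) :=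
  TopologicalSpace.coinduced
    (Matrix.ProjGenLinGroup.mk : Matrix.GeneralLinearGroup (Fin (n + 1)) ℝ → PGLR n) inferInstance

/-! ### The round Riemannian distance on projective space -/

namespace RPn

variable {n : ℕ}

/-- A representative of a point of projective space, as a vector of Euclidean space. -/
def vec (x : RPn n) : EuclideanSpace ℝ (Fin (n + 1)) := WithLp.toLp 2 x.rep

lemma vec_ne_zero (x : RPn n) : vec x ≠ 0 := by
  intro h
  exact x.rep_nonzero (by simpa [vec] using congrArg WithLp.ofLp h)

/-- The distance of the round Riemannian metric: the angle between two lines in `ℝⁿ⁺¹`. -/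
def angleDist (x y : RPn n) : ℝ :=
  min (InnerProductGeometry.angle (vec x) (vec y))
    (Real.pi - InnerProductGeometry.angle (vec x) (vec y))

lemma eq_of_vec_eq_smul {x y : RPn n} {r : ℝ} (h : vec y = r • vec x) : x = y := by
  have h' : y.rep = r • x.rep := by simpa [vec] using congrArg WithLp.ofLp h
  have hr : r ≠ 0 := by
    rintro rfl
    exact y.rep_nonzero (by simpa using h')
  rw [← x.mk_rep, ← y.mk_rep, Projectivization.mk_eq_mk_iff']
  exact ⟨r⁻¹, by rw [h', smul_smul, inv_mul_cancel₀ hr, one_smul]⟩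

instance instMetricSpace : MetricSpace (RPn n) where
  dist := angleDist
  dist_self x := by
    simp [angleDist, InnerProductGeometry.angle_self (vec_ne_zero x), Real.pi_pos.le]
  dist_comm x y := by
    simp [angleDist, InnerProductGeometry.angle_comm]
  dist_triangle x y z := by
    have h1 := InnerProductGeometry.angle_le_angle_add_angle (vec x) (vec y) (vec z)
    have h2 := InnerProductGeometry.angle_le_angle_add_angle (vec x) (-vec y) (vec z)
    have h3 := InnerProductGeometry.angle_le_angle_add_angle (vec x) (vec y) (-vec z)
    have h4 := InnerProductGeometry.angle_le_angle_add_angle (vec x) (-vec y) (-vec z)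
    rw [InnerProductGeometry.angle_neg_right, InnerProductGeometry.angle_neg_left] at h2
    rw [InnerProductGeometry.angle_neg_right, InnerProductGeometry.angle_neg_right] at h3
    rw [InnerProductGeometry.angle_neg_right, InnerProductGeometry.angle_neg_right,
      InnerProductGeometry.angle_neg_neg] at h4
    simp only [angleDist]
    grind
  eq_of_dist_eq_zero {x y} h := by
    change angleDist x y = 0 at h
    rcases min_choice (InnerProductGeometry.angle (vec x) (vec y))
      (Real.pi - InnerProductGeometry.angle (vec x) (vec y)) with h' | h'
    · obtain ⟨_, r, _, hr⟩ := InnerProductGeometry.angle_eq_zero_iff.1 (h'.symm.trans h)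
      exact eq_of_vec_eq_smul hr
    · obtain ⟨_, r, _, hr⟩ := InnerProductGeometry.angle_eq_pi_iff.1
        (sub_eq_zero.1 (h'.symm.trans h)).symm
      exact eq_of_vec_eq_smul hr

/-! ### Convexity in projective space -/

/-- The projective segment `{[s u + t v] : s, t ≥ 0}` spanned by two nonzero vectors.  If `[u]` and
`[v]` are distinct, the two segments of the projective line through them that have these endpoints
are `segment u v` and `segment u (-v)`. -/
def segment (u v : Fin (n + 1) → ℝ) : Set (RPn n) :=
  {x | ∃ (s t : ℝ) (h : s • u + t • v ≠ 0), 0 ≤ s ∧ 0 ≤ t ∧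
    x = Projectivization.mk ℝ (s • u + t • v) h}

/-- The points of projective space that lie in the projectivization of a linear subspace. -/
def ofSubmodule (W : Submodule ℝ (Fin (n + 1) → ℝ)) : Set (RPn n) :=
  {x | x.submodule ≤ W}

/-- Every two points of `Ω` are joined by a segment of a projective line inside `Ω`. -/
def IsConvex (Ω : Set (RPn n)) : Prop :=
  ∀ p ∈ Ω, ∀ q ∈ Ω, ∃ (u v : Fin (n + 1) → ℝ) (hu : u ≠ 0) (hv : v ≠ 0),
    p = Projectivization.mk ℝ u hu ∧ q = Projectivization.mk ℝ v hv ∧ segment u v ⊆ Ω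

/-- `Ω` is convex and its closure contains no projective line.  Openness is not part of this
definition, so that sets containing some of their frontier points are allowed. -/
def IsProperlyConvex (Ω : Set (RPn n)) : Prop :=
  IsConvex Ω ∧ ∀ W : Submodule ℝ (Fin (n + 1) → ℝ), Module.finrank ℝ W = 2 →
    ¬ ofSubmodule W ⊆ closure Ω

/-- A subset of `n`-dimensional projective space has dimension `n` if its interior is nonempty. -/
def HasFullDim (Ω : Set (RPn n)) : Prop := (interior Ω).Nonempty

/-- The distance defining the Hausdorff boundary topology: both the sets and their frontiers are
compared in the Hausdorff distance. -/
def hausdorffBoundaryEDist (A B : Set (RPn n)) : ENNReal :=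
  max (Metric.hausdorffEDist A B) (Metric.hausdorffEDist (frontier A) (frontier B))

end RPn

/-! ### Representations and the character variety -/

/-- The set of representations `Hom(G, PGL(n + 1, ℝ))`. -/
abbrev PRep (G : Type*) [Group G] (n : ℕ) := G →* PGLR n

namespace PRep

variable {G : Type*} [Group G] {n : ℕ}

/-- The topology of pointwise convergence on `Hom(G, PGL(n + 1, ℝ))`. -/
instance instTopologicalSpace : TopologicalSpace (PRep G n) :=
  TopologicalSpace.induced (fun (ρ : PRep G n) (g : G) => ρ g) inferInstance

/-- The conjugate representation `g ↦ β ρ(g) β⁻¹`. -/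
def conj (β : PGLR n) (ρ : PRep G n) : PRep G n := (MulAut.conj β).toMonoidHom.comp ρ

/-- `ρ(G)` preserves the set `Ω`. -/
def Preserves (ρ : PRep G n) (Ω : Set (RPn n)) : Prop := ∀ g : G, ρ g • Ω = Ω

/-- The closure of the conjugacy class of a representation. -/
def orbitClosure (ρ : PRep G n) : Set (PRep G n) := closure (Set.range fun β : PGLR n => conj β ρ)

variable (G n) in
/-- The character variety `Hom(G, PGL(n + 1, ℝ)) // PGL(n + 1, ℝ)`: the quotient of the space of
representations in the sense of real geometric invariant theory, identifying representations
whose orbit closures meet.  It refines every quotient by invariant functions: each continuous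
conjugation-invariant map from `Hom(G, PGL(n + 1, ℝ))` to a Hausdorff space factors through it. -/
def CharacterVariety : Type _ :=
  Quot fun ρ σ : PRep G n => (orbitClosure ρ ∩ orbitClosure σ).Nonempty

/-- The projection from `Hom(G, PGL(n + 1, ℝ))` to the character variety. -/
def χ (ρ : PRep G n) : CharacterVariety G n := Quot.mk _ ρ

end PRep

end

/-! Each `Ω k` lifts to a closed salient convex cone `K` with interior
(`IsProperlyConvex.exists_isConeLift`), and each `ρ k g` has a matrix representative preserving it.
The essential point is a normalization of cones (`IsSalientCone.exists_normalization`), built from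
two frames of maximal determinant in the manner of Auerbach. The first is taken in the unit ball of
the dual cone, and the sum of its functionals is a functional `f` positive on `K \ {0}`. The second
is taken in the slice `K ∩ {f = 1}`, and `B` sends it to the standard basis. Then `B K` lies between
the nonnegative orthant and the fixed salient cone `{|x i| ≤ ∑ x j}`, so these cones cannot
degenerate. Moreover, if `A` preserves `K` and has entries at most `M`, then `B A B⁻¹` has entries
at most `(n + 1)² M`, whatever the size of `B`.

The normalized cones are encoded by height functions (`IsHeight`), which are all 1-Lipschitz. Since
`G` is countable, one diagonal extraction makes the heights and all the conjugated matrices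
converge. Conjugation preserves determinants, so the limit matrices are invertible. The limit height
defines `Ω`. Pointwise convergence of heights gives Hausdorff convergence of both the closures and
the frontiers.

For the character variety, write `B k = U D² V` with `U`, `V` orthogonal and `D` diagonal. Along an
ultrafilter `U` and `V` converge. Conjugating `ρ_∞`, rotated by the limit of `V`, by `D`, and
conjugating `σ`, rotated back by the limit of `U`, by `D⁻¹`, gives the same limit representation:
entrywise this is `Real.exists_common_ultralimit`. Hence the two orbit closures meet, and a single
generating relation already identifies `σ` with `ρ_∞`. -/

/-! ### Topology of the projective linear group and lifts to matrices -/

open Matrix.ProjGenLinGroup in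
lemma PGLR.continuous_mk {n : ℕ} :
    Continuous (mk : Matrix.GeneralLinearGroup (Fin (n + 1)) ℝ → PGLR n) :=
  continuous_coinduced_rng

instance PGLR.instIsTopologicalGroup (n : ℕ) : IsTopologicalGroup (PGLR n) :=
  inferInstanceAs (IsTopologicalGroup
    (Matrix.GeneralLinearGroup (Fin (n + 1)) ℝ ⧸
      Subgroup.center (Matrix.GeneralLinearGroup (Fin (n + 1)) ℝ)))

/-- Centralizers are closed, so the quotient by the center is Hausdorff. Uniqueness of limits is
what makes a pointwise limit of representations multiplicative. -/
instance PGLR.instT2Space (n : ℕ) : T2Space (PGLR n) := by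
  have h : IsClosed (Subgroup.center (Matrix.GeneralLinearGroup (Fin (n + 1)) ℝ) :
      Set (Matrix.GeneralLinearGroup (Fin (n + 1)) ℝ)) := by
    rw [Subgroup.coe_center, ← Set.centralizer_univ]
    exact Set.isClosed_centralizer _
  have : T3Space (Matrix.GeneralLinearGroup (Fin (n + 1)) ℝ ⧸
      Subgroup.center (Matrix.GeneralLinearGroup (Fin (n + 1)) ℝ)) :=
    QuotientGroup.instT3Space _
  exact inferInstanceAs (T2Space (Matrix.GeneralLinearGroup (Fin (n + 1)) ℝ ⧸
      Subgroup.center (Matrix.GeneralLinearGroup (Fin (n + 1)) ℝ)))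

/-- The unit topology also asks for convergence of the inverses, which the adjugate formula supplies
because the limit determinant is nonzero. -/
lemma Matrix.GeneralLinearGroup.tendsto_iff {ι m : Type*} [Fintype m] [DecidableEq m]
    {F : Filter ι} {A : ι → Matrix.GeneralLinearGroup m ℝ} {B : Matrix.GeneralLinearGroup m ℝ} :
    Tendsto A F (𝓝 B) ↔ Tendsto (fun k => (A k : Matrix m m ℝ)) F (𝓝 (B : Matrix m m ℝ)) := by
  refine ⟨fun h => (Units.continuous_val.tendsto _).comp h, fun h => ?_⟩
  have hinv : Tendsto (fun k => ((A k)⁻¹ : Matrix.GeneralLinearGroup m ℝ).val) F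
      (𝓝 (B⁻¹ : Matrix.GeneralLinearGroup m ℝ).val) := by
    simp only [Matrix.coe_units_inv, Matrix.inv_def, Ring.inverse_eq_inv']
    have hd : Tendsto (fun k => (A k : Matrix m m ℝ).det) F (𝓝 (B : Matrix m m ℝ).det) :=
      ((continuous_id.matrix_det).tendsto _).comp h
    have ha : Tendsto (fun k => (A k : Matrix m m ℝ).adjugate) F
        (𝓝 (B : Matrix m m ℝ).adjugate) :=
      ((continuous_id.matrix_adjugate).tendsto _).comp h
    exact (hd.inv₀ (B.isUnit.map Matrix.detMonoidHom).ne_zero).smul ha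
  rw [Units.isInducing_embedProduct.tendsto_nhds_iff]
  exact Filter.Tendsto.prodMk_nhds h ((MulOpposite.continuous_op.tendsto _).comp hinv)

lemma Matrix.GeneralLinearGroup.tendsto_iff_entry {ι m : Type*} [Fintype m] [DecidableEq m]
    {F : Filter ι} {A : ι → Matrix.GeneralLinearGroup m ℝ} {B : Matrix.GeneralLinearGroup m ℝ} :
    Tendsto A F (𝓝 B) ↔ ∀ i j, Tendsto (fun k => (A k : Matrix m m ℝ) i j) F (𝓝 (B i j)) := by
  exact Matrix.GeneralLinearGroup.tendsto_iff.trans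
    (tendsto_pi_nhds.trans (forall_congr' fun i => tendsto_pi_nhds))

/-- Multiplication of an invertible matrix by a nonzero scalar. -/
def Matrix.GeneralLinearGroup.scale {m : Type*} [Fintype m] [DecidableEq m] (c : ℝˣ)
    (A : Matrix.GeneralLinearGroup m ℝ) : Matrix.GeneralLinearGroup m ℝ :=
  A * Matrix.GeneralLinearGroup.scalar m c

lemma Matrix.GeneralLinearGroup.coe_scale {m : Type*} [Fintype m] [DecidableEq m] (c : ℝˣ)
    (A : Matrix.GeneralLinearGroup m ℝ) :
    (A.scale c : Matrix m m ℝ) = (c : ℝ) • (A : Matrix m m ℝ) := by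
  simp [scale, Matrix.smul_eq_mul_diagonal]

lemma PGLR.mk_scale {n : ℕ} (c : ℝˣ) (A : Matrix.GeneralLinearGroup (Fin (n + 1)) ℝ) :
    (Matrix.ProjGenLinGroup.mk (A.scale c) : PGLR n) = .mk A := by
  simp [Matrix.GeneralLinearGroup.scale]

lemma PGLR.exists_scale_of_mk_eq {n : ℕ} {A B : Matrix.GeneralLinearGroup (Fin (n + 1)) ℝ}
    (h : (Matrix.ProjGenLinGroup.mk A : PGLR n) = .mk B) : ∃ c : ℝˣ, B = A.scale c := by
  obtain ⟨u, hu⟩ := Matrix.ProjGenLinGroup.mk_eq_mk_iff.1 h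
  exact ⟨u, hu.symm⟩

/-- Near each point of `PGL(n + 1, ℝ)` there is a continuous choice of representatives. -/
lemma PGLR.exists_section {n : ℕ} (A : Matrix.GeneralLinearGroup (Fin (n + 1)) ℝ) :
    ∃ s : PGLR n → Matrix.GeneralLinearGroup (Fin (n + 1)) ℝ,
      (∀ x, Matrix.ProjGenLinGroup.mk (s x) = x) ∧ Tendsto s (𝓝 (.mk A)) (𝓝 A) := by
  classical
  obtain ⟨i, j, hij⟩ : ∃ i j, (A : Matrix (Fin (n + 1)) (Fin (n + 1)) ℝ) i j ≠ 0 := by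
    by_contra! h
    have : (A : Matrix (Fin (n + 1)) (Fin (n + 1)) ℝ) = 0 := by ext i j; exact h i j
    exact A.ne_zero this
  choose out hout using Matrix.ProjGenLinGroup.mk_surjective (n := Fin (n + 1)) (R := ℝ)
  -- Rescale so that the `(i, j)` entry agrees with that of `A`. Where this entry vanishes any
  -- representative will do: such points stay away from the class of `A`, and continuity is claimed
  -- only there.
  let s : PGLR n → Matrix.GeneralLinearGroup (Fin (n + 1)) ℝ := fun x =>
    if h : out x i j ≠ 0 then (out x).scale (Units.mk0 (A i j / out x i j) (div_ne_zero hij h))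
    else out x
  have hs : ∀ x, Matrix.ProjGenLinGroup.mk (s x) = x := by
    intro x
    by_cases h : out x i j ≠ 0
    · simp only [s, dif_pos h, PGLR.mk_scale, hout]
    · simp only [s, dif_neg h, hout]
  refine ⟨s, hs, ?_⟩
  have hopen : 𝓝 (Matrix.ProjGenLinGroup.mk A : PGLR n) = map Matrix.ProjGenLinGroup.mk (𝓝 A) :=
    QuotientGroup.nhds_eq (Subgroup.center (Matrix.GeneralLinearGroup (Fin (n + 1)) ℝ)) A
  rw [hopen, tendsto_map'_iff, Matrix.GeneralLinearGroup.tendsto_iff_entry]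
  have hA : ∀ a b, Tendsto (fun B : Matrix.GeneralLinearGroup (Fin (n + 1)) ℝ => B a b) (𝓝 A)
      (𝓝 (A a b)) := fun a b =>
    Matrix.GeneralLinearGroup.tendsto_iff_entry.1 tendsto_id a b
  intro a b
  have hev : ∀ᶠ B in 𝓝 A, B i j ≠ 0 := (hA i j).eventually_ne hij
  have hlim : Tendsto (fun B : Matrix.GeneralLinearGroup (Fin (n + 1)) ℝ =>
      (A i j / B i j) * B a b) (𝓝 A) (𝓝 ((A i j / A i j) * A a b)) :=
    (tendsto_const_nhds.div (hA i j) hij).mul (hA a b)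
  rw [div_self hij, one_mul] at hlim
  refine hlim.congr' ?_
  filter_upwards [hev] with B hB
  obtain ⟨c, hc⟩ := PGLR.exists_scale_of_mk_eq (hout (.mk B)).symm
  have hent : ∀ a b, out (.mk B) a b = (c : ℝ) * B a b := by
    intro a b
    rw [hc, Matrix.GeneralLinearGroup.coe_scale]
    rfl
  have hne : out (.mk B) i j ≠ 0 := by
    rw [hent]; exact mul_ne_zero c.ne_zero hB
  have hc0 : (c : ℝ) ≠ 0 := c.ne_zero
  simp only [Function.comp, s, dif_pos hne, Matrix.GeneralLinearGroup.coe_scale,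
    Matrix.smul_apply, smul_eq_mul, Units.val_mk0]
  rw [hent, hent]
  field_simp

/-- A convergent family in `PGL(n + 1, ℝ)` lifts to a convergent family of matrices. -/
lemma PGLR.exists_lift_tendsto {ι : Type*} {n : ℕ} {F : Filter ι} {x : ι → PGLR n}
    {A : Matrix.GeneralLinearGroup (Fin (n + 1)) ℝ} (h : Tendsto x F (𝓝 (.mk A))) :
    ∃ B : ι → Matrix.GeneralLinearGroup (Fin (n + 1)) ℝ,
      (∀ k, Matrix.ProjGenLinGroup.mk (B k) = x k) ∧ Tendsto B F (𝓝 A) := by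
  obtain ⟨s, hs, hlim⟩ := PGLR.exists_section A
  exact ⟨fun k => s (x k), fun k => hs _, hlim.comp h⟩

lemma PRep.tendsto_iff {ι G : Type*} [Group G] {n : ℕ} {F : Filter ι} {ρ : ι → PRep G n}
    {σ : PRep G n} : Tendsto ρ F (𝓝 σ) ↔ ∀ g, Tendsto (fun k => ρ k g) F (𝓝 (σ g)) := by
  rw [nhds_induced, tendsto_comap_iff, tendsto_pi_nhds]
  rfl

/-- A pointwise limit of representations is a representation. -/
lemma PRep.exists_tendsto {ι G : Type*} [Group G] {n : ℕ} {F : Filter ι} [F.NeBot]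
    {ρ : ι → PRep G n} {t : G → PGLR n} (h : ∀ g, Tendsto (fun k => ρ k g) F (𝓝 (t g))) :
    ∃ σ : PRep G n, (∀ g, σ g = t g) ∧ Tendsto ρ F (𝓝 σ) := by
  have h' : Tendsto (fun k (g : G) => ρ k g) F (𝓝 t) := tendsto_pi_nhds.2 h
  exact ⟨monoidHomOfTendsto t ρ h', fun g => rfl, PRep.tendsto_iff.2 h⟩

/-! ### Orbit closures meet: singular values and ultralimits -/

/-- The invertible diagonal matrix with the given diagonal entries. -/
def Matrix.GeneralLinearGroup.diag {m : Type*} [Fintype m] [DecidableEq m] (c : m → ℝˣ) :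
    Matrix.GeneralLinearGroup m ℝ where
  val := Matrix.diagonal fun i => (c i : ℝ)
  inv := Matrix.diagonal fun i => ((c i)⁻¹ : ℝˣ)
  val_inv := by simp [Matrix.diagonal_mul_diagonal]
  inv_val := by simp [Matrix.diagonal_mul_diagonal]

lemma Matrix.GeneralLinearGroup.coe_diag {m : Type*} [Fintype m] [DecidableEq m] (c : m → ℝˣ) :
    (diag c : Matrix m m ℝ) = Matrix.diagonal fun i => (c i : ℝ) := rfl

lemma Matrix.GeneralLinearGroup.coe_diag_inv {m : Type*} [Fintype m] [DecidableEq m]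
    (c : m → ℝˣ) :
    (((diag c)⁻¹ : Matrix.GeneralLinearGroup m ℝ) : Matrix m m ℝ) =
      Matrix.diagonal fun i => (((c i)⁻¹ : ℝˣ) : ℝ) := rfl

lemma Matrix.GeneralLinearGroup.diag_mul_mul_inv_apply {m : Type*} [Fintype m] [DecidableEq m]
    (c : m → ℝˣ) (A : Matrix.GeneralLinearGroup m ℝ) (i j : m) :
    (diag c * A * (diag c)⁻¹ : Matrix.GeneralLinearGroup m ℝ) i j =
      ((c i : ℝ) / c j) * A i j := by
  simp only [Matrix.GeneralLinearGroup.coe_mul, coe_diag, coe_diag_inv, Matrix.mul_diagonal,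
    Matrix.diagonal_mul, Units.val_inv_eq_inv_val]
  ring

lemma Matrix.GeneralLinearGroup.diag_inv_mul_mul_apply {m : Type*} [Fintype m] [DecidableEq m]
    (c : m → ℝˣ) (A : Matrix.GeneralLinearGroup m ℝ) (i j : m) :
    ((diag c)⁻¹ * A * diag c : Matrix.GeneralLinearGroup m ℝ) i j =
      ((c i : ℝ) / c j)⁻¹ * A i j := by
  simp only [Matrix.GeneralLinearGroup.coe_mul, coe_diag, coe_diag_inv, Matrix.mul_diagonal,
    Matrix.diagonal_mul, Units.val_inv_eq_inv_val]
  rw [inv_div]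
  ring

/-- The singular value decomposition of an invertible real matrix, with the diagonal factor written
as a square. -/
lemma Matrix.GeneralLinearGroup.exists_singular_value_decomposition {m : Type*} [Fintype m]
    [DecidableEq m] (B : Matrix.GeneralLinearGroup m ℝ) :
    ∃ (U V : Matrix.GeneralLinearGroup m ℝ) (c : m → ℝˣ),
      (U : Matrix m m ℝ) ∈ Matrix.unitaryGroup m ℝ ∧ (V : Matrix m m ℝ) ∈ Matrix.unitaryGroup m ℝ ∧
      (∀ i, 0 < (c i : ℝ)) ∧ B = U * (diag c * diag c) * V := by
  set H : Matrix m m ℝ := (B : Matrix m m ℝ).conjTranspose * (B : Matrix m m ℝ) with hH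
  have hpd : H.PosDef := Matrix.PosDef.conjTranspose_mul_self _
    (Matrix.mulVec_injective_iff_isUnit.2 B.isUnit)
  have hsp := hpd.isHermitian.spectral_theorem
  set W := hpd.isHermitian.eigenvectorUnitary with hW
  have hpos := hpd.eigenvalues_pos
  -- The singular values are the square roots of these eigenvalues. A second root is taken because
  -- the diagonal factor is to be a square.
  let c : m → ℝˣ := fun i => Units.mk0 (√(√(hpd.isHermitian.eigenvalues i)))
    (by have := hpos i; positivity)
  let WG : Matrix.GeneralLinearGroup m ℝ := Unitary.toUnits W
  have hWG : (WG : Matrix m m ℝ) = W := rfl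
  have hWGi : ((WG⁻¹ : Matrix.GeneralLinearGroup m ℝ) : Matrix m m ℝ) = star (W : Matrix m m ℝ) := rfl
  have hD : (diag c * diag c * (diag c * diag c) : Matrix.GeneralLinearGroup m ℝ).val =
      Matrix.diagonal hpd.isHermitian.eigenvalues := by
    simp only [Matrix.GeneralLinearGroup.coe_mul, coe_diag, Matrix.diagonal_mul_diagonal]
    congr 1
    ext i
    simp only [c, Units.val_mk0]
    rw [Real.mul_self_sqrt (Real.sqrt_nonneg _), Real.mul_self_sqrt (hpos i).le]
  -- `U` is forced by the factorization; it is orthogonal because `W` diagonalizes `H = Bᴴ B` to the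
  -- fourth power of `diag c`.
  let U : Matrix.GeneralLinearGroup m ℝ := B * WG * (diag c * diag c)⁻¹
  have hds : star (((diag c * diag c)⁻¹ : Matrix.GeneralLinearGroup m ℝ) : Matrix m m ℝ) =
      ((diag c * diag c)⁻¹ : Matrix.GeneralLinearGroup m ℝ) := by
    rw [_root_.mul_inv_rev]
    simp only [Matrix.GeneralLinearGroup.coe_mul, coe_diag_inv, Matrix.diagonal_mul_diagonal,
      Matrix.star_eq_conjTranspose, Matrix.diagonal_conjTranspose]
    simp
  have hHW : star (W : Matrix m m ℝ) * H * (W : Matrix m m ℝ) =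
      Matrix.diagonal hpd.isHermitian.eigenvalues := by
    rw [Unitary.conjStarAlgAut_apply] at hsp
    have h1 : star (W : Matrix m m ℝ) * (W : Matrix m m ℝ) = 1 := Unitary.coe_star_mul_self W
    calc star (W : Matrix m m ℝ) * H * (W : Matrix m m ℝ)
        = (star (W : Matrix m m ℝ) * (W : Matrix m m ℝ)) *
            Matrix.diagonal hpd.isHermitian.eigenvalues *
            (star (W : Matrix m m ℝ) * (W : Matrix m m ℝ)) := by
          conv_lhs => rw [hsp]
          simp only [mul_assoc]
          rfl
      _ = Matrix.diagonal hpd.isHermitian.eigenvalues := by rw [h1, one_mul, mul_one]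
  refine ⟨U, WG⁻¹, c, ?_, ?_, ?_, ?_⟩
  · rw [Matrix.mem_unitaryGroup_iff']
    simp only [U, Matrix.GeneralLinearGroup.coe_mul _ _, hWG] 
    rw [star_mul, star_mul, hds]
    have : ∀ X Y : Matrix m m ℝ, X * (star (W : Matrix m m ℝ) * star (B : Matrix m m ℝ)) *
        ((B : Matrix m m ℝ) * (W : Matrix m m ℝ) * Y) =
        X * (star (W : Matrix m m ℝ) * H * (W : Matrix m m ℝ)) * Y := by
      intro X Y
      simp only [hH, Matrix.star_eq_conjTranspose, mul_assoc]
    rw [this, hHW, ← hD, ← Units.val_mul, ← Units.val_mul]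
    rw [show (diag c * diag c)⁻¹ * (diag c * diag c * (diag c * diag c)) * (diag c * diag c)⁻¹ =
      (1 : Matrix.GeneralLinearGroup m ℝ) by group, Units.val_one]
  · rw [hWGi]
    exact (star W).2
  · intro i
    have := hpos i
    simp only [c, Units.val_mk0]
    positivity
  · simp only [U]
    group

/-- Ultralimits of orthogonal matrices exist. -/
lemma Matrix.GeneralLinearGroup.exists_tendsto_of_unitary {ι m : Type*} [Fintype m]
    [DecidableEq m] (F : Ultrafilter ι) (U : ι → Matrix.GeneralLinearGroup m ℝ)
    (hU : ∀ k, (U k : Matrix m m ℝ) ∈ Matrix.unitaryGroup m ℝ) :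
    ∃ W : Matrix.GeneralLinearGroup m ℝ, Tendsto U F (𝓝 W) := by
  have h1 : ∀ i j, ∃ x : ℝ, Tendsto (fun k => (U k : Matrix m m ℝ) i j) F (𝓝 x) := by
    intro i j
    obtain ⟨x, -, hx⟩ := (isCompact_closedBall (0 : ℝ) 1).ultrafilter_le_nhds
      (F.map fun k => (U k : Matrix m m ℝ) i j)
      (by
        rw [le_principal_iff]
        refine Ultrafilter.mem_map.2 (Filter.univ_mem' fun k => ?_)
        simpa using entry_norm_bound_of_unitary (hU k) i j)
    exact ⟨x, hx⟩
  choose x hx using h1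
  have hlim : Tendsto (fun k => (U k : Matrix m m ℝ)) F (𝓝 (Matrix.of x)) :=
    tendsto_pi_nhds.2 fun i => tendsto_pi_nhds.2 fun j => hx i j
  have hstar : Tendsto (fun k => (U k : Matrix m m ℝ) * star (U k : Matrix m m ℝ)) F
      (𝓝 (Matrix.of x * star (Matrix.of x))) := hlim.mul hlim.star
  have h2 : Matrix.of x * star (Matrix.of x) = 1 := by
    refine tendsto_nhds_unique hstar (tendsto_const_nhds.congr fun k => ?_)
    exact (Matrix.mem_unitaryGroup_iff.1 (hU k)).symm
  refine ⟨⟨Matrix.of x, star (Matrix.of x), h2, ?_⟩, ?_⟩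
  · exact mul_eq_one_comm.1 h2
  · exact Matrix.GeneralLinearGroup.tendsto_iff.2 hlim

/-- If `r` has a finite ultralimit `q`, then `y = q² x` and both sequences tend to `q x`; for `q =
0` the second one is identically zero. If `r` tends to infinity, then `x = 0` and both limits are
`0`. -/
lemma Real.exists_common_ultralimit {ι : Type*} (F : Ultrafilter ι) {r a : ι → ℝ} {x y : ℝ}
    (hr : ∀ k, 0 < r k) (ha : Tendsto a F (𝓝 x)) (hra : Tendsto (fun k => r k ^ 2 * a k) F (𝓝 y)) :
    ∃ z, Tendsto (fun k => r k * x) F (𝓝 z) ∧ Tendsto (fun k => (r k)⁻¹ * y) F (𝓝 z) := by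
  by_cases hb : ∃ C, ∀ᶠ k in F, r k ≤ C
  · obtain ⟨C, hC⟩ := hb
    obtain ⟨q, hq, hlim⟩ := (isCompact_Icc (a := (0 : ℝ)) (b := C)).ultrafilter_le_nhds (F.map r)
      (by
        rw [le_principal_iff]
        refine Ultrafilter.mem_map.2 ?_
        filter_upwards [hC] with k hk using ⟨(hr k).le, hk⟩)
    have hlim : Tendsto r F (𝓝 q) := hlim
    have hy : y = q ^ 2 * x := tendsto_nhds_unique hra ((hlim.pow 2).mul ha)
    refine ⟨q * x, hlim.mul_const x, ?_⟩
    rcases eq_or_ne q 0 with rfl | hq0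
    · simp [hy]
    · have := (hlim.inv₀ hq0).mul_const y
      rwa [hy, show q⁻¹ * (q ^ 2 * x) = q * x by field_simp, ← hy] at this
  -- Along an ultrafilter, failing to be eventually at most `C` means being eventually above `C`, so
  -- unboundedness is already divergence to infinity.
  · push Not at hb
    have htop : Tendsto r F atTop := by
      rw [tendsto_atTop]
      intro C
      filter_upwards [hb C] with k hk using hk.le
    have hinv : Tendsto (fun k => (r k)⁻¹) F (𝓝 0) := tendsto_inv_atTop_zero.comp htop
    have hx : x = 0 := by
      refine tendsto_nhds_unique ha ?_
      have := (hinv.pow 2).mul hra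
      simp only [ne_eq, OfNat.ofNat_ne_zero, not_false_eq_true, zero_pow, zero_mul] at this
      refine this.congr fun k => ?_
      have := (hr k).ne'
      field_simp
    refine ⟨0, by simp [hx], ?_⟩
    simpa using hinv.mul_const y

/-- Conjugation by `diag c` multiplies the `(i, j)` entry by `r = c i / c j`, and conjugation by its
square by `r²`. The scalar lemma therefore applies entry by entry. -/
lemma Matrix.GeneralLinearGroup.exists_common_ultralimit {ι m : Type*} [Fintype m]
    [DecidableEq m] (F : Ultrafilter ι) {c : ι → m → ℝˣ} (hc : ∀ k i, 0 < (c k i : ℝ))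
    {A : ι → Matrix.GeneralLinearGroup m ℝ} {X Y : Matrix.GeneralLinearGroup m ℝ}
    (hA : Tendsto A F (𝓝 X))
    (hM : Tendsto (fun k => (diag (c k) * diag (c k)) * A k * (diag (c k) * diag (c k))⁻¹) F
      (𝓝 Y)) :
    ∃ Z : Matrix.GeneralLinearGroup m ℝ,
      Tendsto (fun k => diag (c k) * X * (diag (c k))⁻¹) F (𝓝 Z) ∧
      Tendsto (fun k => (diag (c k))⁻¹ * Y * diag (c k)) F (𝓝 Z) := by
  have h : ∀ i j, ∃ z, Tendsto (fun k => ((c k i : ℝ) / c k j) * X i j) F (𝓝 z) ∧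
      Tendsto (fun k => ((c k i : ℝ) / c k j)⁻¹ * Y i j) F (𝓝 z) := by
    intro i j
    refine Real.exists_common_ultralimit F (fun k => div_pos (hc k i) (hc k j))
      (Matrix.GeneralLinearGroup.tendsto_iff_entry.1 hA i j) ?_
    refine (Matrix.GeneralLinearGroup.tendsto_iff_entry.1 hM i j).congr fun k => ?_
    have : (diag (c k) * diag (c k)) * A k * (diag (c k) * diag (c k))⁻¹ =
        diag (c k) * (diag (c k) * A k * (diag (c k))⁻¹) * (diag (c k))⁻¹ := by group
    rw [this, diag_mul_mul_inv_apply, diag_mul_mul_inv_apply]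
    ring
  choose z hz1 hz2 using h
  have hlim1 : Tendsto (fun k => ((diag (c k) * X * (diag (c k))⁻¹ :
      Matrix.GeneralLinearGroup m ℝ) : Matrix m m ℝ)) F (𝓝 (Matrix.of z)) :=
    tendsto_pi_nhds.2 fun i => tendsto_pi_nhds.2 fun j =>
      (hz1 i j).congr fun k => (diag_mul_mul_inv_apply _ _ _ _).symm
  -- Determinants are invariant under conjugation, so the entrywise limit is invertible.
  have hdet : (Matrix.of z).det = (X : Matrix m m ℝ).det := by
    refine tendsto_nhds_unique (((continuous_id.matrix_det).tendsto _).comp hlim1)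
      (tendsto_const_nhds.congr fun k => ?_)
    have := Matrix.det_units_conj (diag (c k)) (X : Matrix m m ℝ)
    exact this.symm
  have hunit : IsUnit (Matrix.of z).det := by
    rw [hdet]
    exact X.isUnit.map Matrix.detMonoidHom
  refine ⟨Matrix.nonsingInvUnit _ hunit, ?_, ?_⟩
  · exact Matrix.GeneralLinearGroup.tendsto_iff.2 hlim1
  · refine Matrix.GeneralLinearGroup.tendsto_iff_entry.2 fun i j => ?_
    exact (hz2 i j).congr fun k => (diag_inv_mul_mul_apply _ _ _ _).symm

/-- The powers bound the absolute values, and `q ≠ 0` keeps the limit away from zero. For even `p`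
the sign of `u k` may alternate, so an ultrafilter is needed. -/
lemma Units.exists_ultralimit_of_pow {ι : Type*} (F : Ultrafilter ι) {u : ι → ℝˣ} {p : ℕ}
    (hp : p ≠ 0) {q : ℝ} (hq : q ≠ 0) (h : Tendsto (fun k => (u k : ℝ) ^ p) F (𝓝 q)) :
    ∃ v : ℝˣ, Tendsto (fun k => (u k : ℝ)) F (𝓝 v) := by
  have hb : ∀ᶠ k in F, |(u k : ℝ)| ≤ max 1 (|q| + 1) := by
    have := (h.abs).eventually_lt_const (lt_add_one |q|)
    filter_upwards [this] with k hk
    by_contra! hlt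
    obtain ⟨h1, h2⟩ := max_lt_iff.1 hlt
    rw [abs_pow] at hk
    exact absurd (le_self_pow₀ h1.le hp) (not_le.2 (hk.trans h2))
  obtain ⟨v, -, hv⟩ := (isCompact_closedBall (0 : ℝ) (max 1 (|q| + 1))).ultrafilter_le_nhds
    (F.map fun k => (u k : ℝ))
    (by
      rw [le_principal_iff]
      refine Ultrafilter.mem_map.2 ?_
      filter_upwards [hb] with k hk
      simpa using hk)
  have hv : Tendsto (fun k => (u k : ℝ)) F (𝓝 v) := hv
  have : v ^ p = q := tendsto_nhds_unique (hv.pow p) h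
  have hv0 : v ≠ 0 := by
    rintro rfl
    exact hq (by rw [← this, zero_pow hp])
  exact ⟨Units.mk0 v hv0, hv⟩

lemma Matrix.GeneralLinearGroup.tendsto_scale {ι m : Type*} [Fintype m] [DecidableEq m]
    {F : Filter ι} {A : ι → Matrix.GeneralLinearGroup m ℝ} {B : Matrix.GeneralLinearGroup m ℝ}
    {c : ι → ℝˣ} {d : ℝˣ} (hA : Tendsto A F (𝓝 B))
    (hc : Tendsto (fun k => (c k : ℝ)) F (𝓝 (d : ℝ))) :
    Tendsto (fun k => (A k).scale (c k)) F (𝓝 (B.scale d)) := by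
  rw [Matrix.GeneralLinearGroup.tendsto_iff] at hA ⊢
  simp only [Matrix.GeneralLinearGroup.coe_scale]
  exact hc.smul hA

lemma PRep.conj_apply {G : Type*} [Group G] {n : ℕ} (β : PGLR n) (ρ : PRep G n) (g : G) :
    PRep.conj β ρ g = β * ρ g * β⁻¹ := rfl

/-- If conjugates of a convergent family of representations converge, then the orbit closures of
the two limits meet. -/
lemma PRep.orbitClosure_inter_nonempty {ι G : Type*} [Group G] {n : ℕ} {F : Filter ι} [F.NeBot]
    {β : ι → PGLR n} {ρ : ι → PRep G n} {ρ' σ : PRep G n} (hρ : Tendsto ρ F (𝓝 ρ'))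
    (hσ : Tendsto (fun k => PRep.conj (β k) (ρ k)) F (𝓝 σ)) :
    (PRep.orbitClosure σ ∩ PRep.orbitClosure ρ').Nonempty := by
  let E : Ultrafilter ι := Ultrafilter.of F
  have hE : (E : Filter ι) ≤ F := Ultrafilter.of_le F
  replace hρ := PRep.tendsto_iff.1 (hρ.mono_left hE)
  replace hσ := PRep.tendsto_iff.1 (hσ.mono_left hE)
  choose B hB using fun k => Matrix.ProjGenLinGroup.mk_surjective (β k)
  choose U V c hU hV hc hBd using fun k =>
    Matrix.GeneralLinearGroup.exists_singular_value_decomposition (B k)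
  obtain ⟨U', hU'⟩ := Matrix.GeneralLinearGroup.exists_tendsto_of_unitary E U hU
  obtain ⟨V', hV'⟩ := Matrix.GeneralLinearGroup.exists_tendsto_of_unitary E V hV
  let D : ι → Matrix.GeneralLinearGroup (Fin (n + 1)) ℝ := fun k => .diag (c k)
  have key : ∀ g, ∃ z : PGLR n,
      Tendsto (fun k => PRep.conj (.mk (D k * V')) ρ' g) E (𝓝 z) ∧
      Tendsto (fun k => PRep.conj (.mk ((D k)⁻¹ * U'⁻¹)) σ g) E (𝓝 z) := by
    intro g
    obtain ⟨A', hA'⟩ := Matrix.ProjGenLinGroup.mk_surjective (ρ' g)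
    obtain ⟨S', hS'⟩ := Matrix.ProjGenLinGroup.mk_surjective (σ g)
    obtain ⟨A, hA, hAlim⟩ := PGLR.exists_lift_tendsto (A := A') (hA' ▸ hρ g)
    obtain ⟨S, hS, hSlim⟩ := PGLR.exists_lift_tendsto (A := S') (hS' ▸ hσ g)
    have hSB : ∀ k, ∃ u : ℝˣ, S k = (B k * A k * (B k)⁻¹).scale u := fun k => by
      refine PGLR.exists_scale_of_mk_eq ?_
      rw [hS, PRep.conj_apply, map_mul, map_mul, map_inv, hB, hA]
    choose u hu using hSB
    -- The lifts `S k` and `B k * A k * (B k)⁻¹` agree only up to the scalar `u k`. Comparing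
    -- determinants controls its `(n + 1)`-st power.
    have hdet : Tendsto (fun k => (u k : ℝ) ^ (n + 1)) E
        (𝓝 ((S' : Matrix (Fin (n + 1)) (Fin (n + 1)) ℝ).det /
          (A' : Matrix (Fin (n + 1)) (Fin (n + 1)) ℝ).det)) := by
      have h1 := ((continuous_id.matrix_det).tendsto _).comp
        (Matrix.GeneralLinearGroup.tendsto_iff.1 hSlim)
      have h2 := ((continuous_id.matrix_det).tendsto _).comp
        (Matrix.GeneralLinearGroup.tendsto_iff.1 hAlim)
      refine (h1.div h2 (A'.isUnit.map Matrix.detMonoidHom).ne_zero).congr fun k => ?_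
      have h3 : ((A k : Matrix (Fin (n + 1)) (Fin (n + 1)) ℝ)).det ≠ 0 :=
        ((A k).isUnit.map Matrix.detMonoidHom).ne_zero
      simp only [Pi.div_apply, Function.comp, id]
      rw [hu, Matrix.GeneralLinearGroup.coe_scale, Matrix.det_smul, Fintype.card_fin,
        Matrix.GeneralLinearGroup.coe_mul, Matrix.GeneralLinearGroup.coe_mul,
        Matrix.det_units_conj, mul_div_cancel_right₀ _ h3]
    obtain ⟨v, hv⟩ := Units.exists_ultralimit_of_pow E (Nat.succ_ne_zero n)
      (div_ne_zero (S'.isUnit.map Matrix.detMonoidHom).ne_zero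
        (A'.isUnit.map Matrix.detMonoidHom).ne_zero) hdet
    have hv' : Tendsto (fun k => (((u k)⁻¹ : ℝˣ) : ℝ)) E (𝓝 ((v⁻¹ : ℝˣ) : ℝ)) := by
      simpa using hv.inv₀ v.ne_zero
    -- The orthogonal factors converge and are absorbed into the two limits. What links the
    -- sequences in `hX` and `hY` is conjugation by `D k * D k` alone, of which each side will
    -- perform one half.
    have hX : Tendsto (fun k => V k * A k * (V k)⁻¹) E (𝓝 (V' * A' * V'⁻¹)) :=
      (hV'.mul hAlim).mul hV'.inv
    have hY : Tendsto (fun k => ((U k)⁻¹ * S k * U k).scale (u k)⁻¹) E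
        (𝓝 ((U'⁻¹ * S' * U').scale v⁻¹)) :=
      Matrix.GeneralLinearGroup.tendsto_scale ((hU'.inv.mul hSlim).mul hU') hv'
    obtain ⟨Z, hZ1, hZ2⟩ := Matrix.GeneralLinearGroup.exists_common_ultralimit E hc hX
      (hY.congr fun k => by
        have hcomm : ∀ X : Matrix.GeneralLinearGroup (Fin (n + 1)) ℝ,
            Matrix.GeneralLinearGroup.scalar (Fin (n + 1)) (u k) * X =
              X * Matrix.GeneralLinearGroup.scalar (Fin (n + 1)) (u k) := fun X =>
          Matrix.GeneralLinearGroup.scalar_commute _ X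
        rw [hu k]
        simp only [Matrix.GeneralLinearGroup.scale, map_inv]
        have h3 := hcomm (U k)
        rw [mul_assoc (U k)⁻¹, mul_assoc _ _ (U k), h3, hBd k]
        group)
    refine ⟨.mk Z, ?_, ?_⟩
    · refine ((PGLR.continuous_mk.tendsto Z).comp hZ1).congr fun k => ?_
      simp only [Function.comp, PRep.conj_apply, ← hA', ← map_mul, ← map_inv, D]
      congr 1
      group
    · refine ((PGLR.continuous_mk.tendsto Z).comp hZ2).congr fun k => ?_
      simp only [Function.comp, PRep.conj_apply, ← hS', map_mul, D, PGLR.mk_scale]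
      simp only [← map_mul, ← map_inv]
      congr 1
      group
  choose z hz1 hz2 using key
  obtain ⟨τ, hτ, hlim1⟩ := PRep.exists_tendsto hz1
  have hlim2 : Tendsto (fun k => PRep.conj (.mk ((D k)⁻¹ * U'⁻¹)) σ) E (𝓝 τ) :=
    PRep.tendsto_iff.2 fun g => by rw [hτ]; exact hz2 g
  exact ⟨τ, mem_closure_of_tendsto hlim2 (Eventually.of_forall fun k => ⟨_, rfl⟩),
    mem_closure_of_tendsto hlim1 (Eventually.of_forall fun k => ⟨_, rfl⟩)⟩

lemma PRep.χ_eq_of_tendsto {ι G : Type*} [Group G] {n : ℕ} {F : Filter ι} [F.NeBot]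
    {β : ι → PGLR n} {ρ : ι → PRep G n} {ρ' σ : PRep G n} (hρ : Tendsto ρ F (𝓝 ρ'))
    (hσ : Tendsto (fun k => PRep.conj (β k) (ρ k)) F (𝓝 σ)) : PRep.χ σ = PRep.χ ρ' :=
  Quot.sound (PRep.orbitClosure_inter_nonempty hρ hσ)

/-! ### The angle metric and the quotient topology of projective space -/

lemma InnerProductGeometry.tendsto_angle_self {ι E : Type*} [NormedAddCommGroup E]
    [InnerProductSpace ℝ E] {F : Filter ι} {f : ι → E} {x : E} (hx : x ≠ 0)
    (h : Tendsto f F (𝓝 x)) : Tendsto (fun k => angle (f k) x) F (𝓝 0) := by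
  have h2 : Tendsto (fun y : E × E => angle y.1 y.2) (𝓝 (x, x)) (𝓝 (angle x x)) :=
    continuousAt_angle hx hx
  rw [angle_self hx] at h2
  have h3 : Tendsto (fun k => (f k, x)) F (𝓝 (x, x)) := h.prodMk_nhds tendsto_const_nhds
  have h4 := Tendsto.comp h2 h3
  exact h4

namespace RPn

variable {n : ℕ}

/-- Replacing a representative by a negative multiple exchanges the angle and its supplement, which
the minimum does not see. -/
lemma dist_mk (v w : Fin (n + 1) → ℝ) (hv : v ≠ 0) (hw : w ≠ 0) :
    dist (Projectivization.mk ℝ v hv) (Projectivization.mk ℝ w hw) =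
      min (InnerProductGeometry.angle (WithLp.toLp 2 v) (WithLp.toLp 2 w))
        (Real.pi - InnerProductGeometry.angle (WithLp.toLp 2 v) (WithLp.toLp 2 w)) := by
  have h : ∀ (u : Fin (n + 1) → ℝ) (hu : u ≠ 0), ∃ a : ℝ, a ≠ 0 ∧
      vec (Projectivization.mk ℝ u hu) = a • WithLp.toLp 2 u := by
    intro u hu
    obtain ⟨a, ha⟩ := Projectivization.exists_smul_eq_mk_rep ℝ u hu
    exact ⟨a, a.ne_zero, by rw [vec, ← ha, Units.smul_def, WithLp.toLp_smul]⟩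
  obtain ⟨a, ha, hav⟩ := h v hv
  obtain ⟨b, hb, hbw⟩ := h w hw
  change angleDist _ _ = _
  rw [angleDist, hav, hbw]
  rcases lt_or_gt_of_ne ha with ha | ha <;> rcases lt_or_gt_of_ne hb with hb | hb <;>
    simp [InnerProductGeometry.angle_smul_left_of_neg, InnerProductGeometry.angle_smul_left_of_pos,
      InnerProductGeometry.angle_smul_right_of_neg, InnerProductGeometry.angle_smul_right_of_pos,
      InnerProductGeometry.angle_neg_left, InnerProductGeometry.angle_neg_right,
      ha, hb, min_comm]

lemma continuous_mk' : Continuous (Projectivization.mk' ℝ : {v : Fin (n + 1) → ℝ // v ≠ 0} → RPn n) := by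
  rw [continuous_iff_continuousAt]
  intro v
  rw [ContinuousAt, tendsto_iff_dist_tendsto_zero]
  have hv : (WithLp.toLp 2 v.1 : EuclideanSpace ℝ (Fin (n + 1))) ≠ 0 := by
    simpa using v.2
  have h1 : Tendsto (fun w : {v : Fin (n + 1) → ℝ // v ≠ 0} =>
      InnerProductGeometry.angle (WithLp.toLp 2 w.1 : EuclideanSpace ℝ (Fin (n + 1)))
        (WithLp.toLp 2 v.1)) (𝓝 v) (𝓝 0) := by
    have h3 : Tendsto (fun w : {v : Fin (n + 1) → ℝ // v ≠ 0} =>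
        (WithLp.toLp 2 w.1 : EuclideanSpace ℝ (Fin (n + 1)))) (𝓝 v) (𝓝 (WithLp.toLp 2 v.1)) :=
      ((PiLp.continuous_toLp 2 (fun _ : Fin (n + 1) => ℝ)).comp
        continuous_subtype_val).tendsto v
    exact InnerProductGeometry.tendsto_angle_self hv h3
  refine squeeze_zero (fun _ => dist_nonneg) (fun w => ?_) h1
  rw [Projectivization.mk'_eq_mk, Projectivization.mk'_eq_mk, dist_mk]
  exact min_le_left _ _

/-- Take the representative of the same norm as `v` whose angle with `v` is the projective distance;
the identity is the law of cosines. This is a section continuous at the class of `v`, which makes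
the projection open. -/
lemma exists_rep_near {v : Fin (n + 1) → ℝ} (hv : v ≠ 0) (x : RPn n) :
    ∃ (w : Fin (n + 1) → ℝ) (hw : w ≠ 0), x = Projectivization.mk ℝ w hw ∧
      ‖(WithLp.toLp 2 (w - v) : EuclideanSpace ℝ (Fin (n + 1)))‖ ^ 2 =
        2 * ‖(WithLp.toLp 2 v : EuclideanSpace ℝ (Fin (n + 1)))‖ ^ 2 *
          (1 - Real.cos (dist x (Projectivization.mk ℝ v hv))) := by
  obtain ⟨r, hr, hx, hang⟩ : ∃ (r : Fin (n + 1) → ℝ) (hr : r ≠ 0), x = Projectivization.mk ℝ r hr ∧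
      dist x (Projectivization.mk ℝ v hv) =
        InnerProductGeometry.angle (WithLp.toLp 2 r) (WithLp.toLp 2 v) := by
    have hd := dist_mk x.rep v x.rep_nonzero hv
    rw [x.mk_rep] at hd
    rcases min_choice (InnerProductGeometry.angle (WithLp.toLp 2 x.rep) (WithLp.toLp 2 v))
        (Real.pi - InnerProductGeometry.angle (WithLp.toLp 2 x.rep) (WithLp.toLp 2 v)) with h | h
    · exact ⟨x.rep, x.rep_nonzero, x.mk_rep.symm, hd.trans h⟩
    · refine ⟨-x.rep, neg_ne_zero.2 x.rep_nonzero, ?_, ?_⟩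
      · conv_lhs => rw [← x.mk_rep]
        rw [Projectivization.mk_eq_mk_iff']
        exact ⟨-1, by simp⟩
      · rw [WithLp.toLp_neg, InnerProductGeometry.angle_neg_left]
        exact hd.trans h
  have hr' : (WithLp.toLp 2 r : EuclideanSpace ℝ (Fin (n + 1))) ≠ 0 := by simpa using hr
  have hv' : (WithLp.toLp 2 v : EuclideanSpace ℝ (Fin (n + 1))) ≠ 0 := by simpa using hv
  have hnr := norm_pos_iff.2 hr'
  have hnv := norm_pos_iff.2 hv'
  set c : ℝ := ‖(WithLp.toLp 2 v : EuclideanSpace ℝ (Fin (n + 1)))‖ /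
    ‖(WithLp.toLp 2 r : EuclideanSpace ℝ (Fin (n + 1)))‖ with hc
  have hcpos : 0 < c := div_pos hnv hnr
  refine ⟨c • r, smul_ne_zero hcpos.ne' hr, ?_, ?_⟩
  · rw [hx, Projectivization.mk_eq_mk_iff']
    exact ⟨c⁻¹, by rw [smul_smul, inv_mul_cancel₀ hcpos.ne', one_smul]⟩
  · rw [WithLp.toLp_sub, WithLp.toLp_smul, hang, norm_sub_sq_real, norm_smul, real_inner_smul_left,
      ← InnerProductGeometry.cos_angle_mul_norm_mul_norm, Real.norm_of_nonneg hcpos.le]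
    have : c * ‖(WithLp.toLp 2 r : EuclideanSpace ℝ (Fin (n + 1)))‖ =
      ‖(WithLp.toLp 2 v : EuclideanSpace ℝ (Fin (n + 1)))‖ := by
      rw [hc]; field_simp
    rw [show c * (Real.cos (InnerProductGeometry.angle (WithLp.toLp 2 r) (WithLp.toLp 2 v)) *
      (‖(WithLp.toLp 2 r : EuclideanSpace ℝ (Fin (n + 1)))‖ *
        ‖(WithLp.toLp 2 v : EuclideanSpace ℝ (Fin (n + 1)))‖)) =
      Real.cos (InnerProductGeometry.angle (WithLp.toLp 2 r) (WithLp.toLp 2 v)) *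
      ((c * ‖(WithLp.toLp 2 r : EuclideanSpace ℝ (Fin (n + 1)))‖) *
        ‖(WithLp.toLp 2 v : EuclideanSpace ℝ (Fin (n + 1)))‖) by ring, this]
    ring

lemma isOpenMap_mk' :
    IsOpenMap (Projectivization.mk' ℝ : {v : Fin (n + 1) → ℝ // v ≠ 0} → RPn n) := by
  rw [isOpenMap_iff_nhds_le]
  rintro ⟨v, hv⟩ S hS
  rw [Projectivization.mk'_eq_mk]
  obtain ⟨T, hT, hTS⟩ := mem_nhds_subtype _ _ _ |>.1 (mem_map.1 hS)
  choose w hw hxw hnorm using exists_rep_near hv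
  have hlim : Tendsto w (𝓝 (Projectivization.mk ℝ v hv)) (𝓝 v) := by
    have h1 : Tendsto (fun x : RPn n => ‖(WithLp.toLp 2 (w x - v) :
        EuclideanSpace ℝ (Fin (n + 1)))‖ ^ 2) (𝓝 (Projectivization.mk ℝ v hv)) (𝓝 0) := by
      simp only [hnorm]
      have : Continuous fun x : RPn n =>
          2 * ‖(WithLp.toLp 2 v : EuclideanSpace ℝ (Fin (n + 1)))‖ ^ 2 *
          (1 - Real.cos (dist x (Projectivization.mk ℝ v hv))) := by fun_prop
      have h2 := this.tendsto (Projectivization.mk ℝ v hv)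
      simpa using h2
    have h3 := h1.sqrt
    simp only [Real.sqrt_sq (norm_nonneg _), Real.sqrt_zero] at h3
    have h4 : Tendsto (fun x : RPn n => (WithLp.toLp 2 (w x - v) :
        EuclideanSpace ℝ (Fin (n + 1)))) (𝓝 (Projectivization.mk ℝ v hv)) (𝓝 0) :=
      tendsto_zero_iff_norm_tendsto_zero.2 h3
    have h5 := ((PiLp.continuous_ofLp 2 (fun _ : Fin (n + 1) => ℝ)).tendsto _).comp h4
    have h6 : Tendsto (fun x => w x - v) (𝓝 (Projectivization.mk ℝ v hv)) (𝓝 0) := by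
      simpa [Function.comp_def] using h5
    simpa using h6.add_const v
  filter_upwards [hlim hT] with x hx
  have := @hTS ⟨w x, hw x⟩ hx
  rw [hxw x]
  simpa [Projectivization.mk'_eq_mk] using this

lemma isOpenQuotientMap_mk' :
    IsOpenQuotientMap (Projectivization.mk' ℝ : {v : Fin (n + 1) → ℝ // v ≠ 0} → RPn n) where
  surjective x := ⟨⟨x.rep, x.rep_nonzero⟩, by rw [Projectivization.mk'_eq_mk, x.mk_rep]⟩
  continuous := continuous_mk'
  isOpenMap := isOpenMap_mk'

instance instCompactSpace : CompactSpace (RPn n) := by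
  let f : Metric.sphere (0 : Fin (n + 1) → ℝ) 1 → RPn n := fun v =>
    Projectivization.mk ℝ v.1 (norm_ne_zero_iff.1 (by rw [mem_sphere_zero_iff_norm.1 v.2]; simp))
  have hf : Continuous f := continuous_mk'.comp
    (continuous_subtype_val.subtype_mk fun v => norm_ne_zero_iff.1
      (by rw [mem_sphere_zero_iff_norm.1 v.2]; simp))
  refine Function.Surjective.compactSpace (f := f) hf (fun x => ?_)
  have hx := norm_pos_iff.2 x.rep_nonzero
  refine ⟨⟨‖x.rep‖⁻¹ • x.rep, ?_⟩, ?_⟩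
  · rw [mem_sphere_zero_iff_norm, norm_smul, norm_inv, norm_norm, inv_mul_cancel₀ hx.ne']
  · conv_rhs => rw [← x.mk_rep]
    simp only [f]
    rw [Projectivization.mk_eq_mk_iff']
    exact ⟨‖x.rep‖⁻¹, rfl⟩

lemma mk_smul_mk (A : Matrix.GeneralLinearGroup (Fin (n + 1)) ℝ) {v : Fin (n + 1) → ℝ}
    (hv : v ≠ 0) : ∃ h : (A : Matrix (Fin (n + 1)) (Fin (n + 1)) ℝ).mulVec v ≠ 0,
      (.mk A : PGLR n) • Projectivization.mk ℝ v hv =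
        Projectivization.mk ℝ ((A : Matrix (Fin (n + 1)) (Fin (n + 1)) ℝ).mulVec v) h :=
  ⟨(smul_ne_zero_iff_ne A).2 hv, Projectivization.PGL.mk_smul_mk A hv⟩

instance instContinuousConstSMul : ContinuousConstSMul (PGLR n) (RPn n) where
  continuous_const_smul g := by
    obtain ⟨A, rfl⟩ := Matrix.ProjGenLinGroup.mk_surjective g
    rw [isOpenQuotientMap_mk'.isQuotientMap.continuous_iff]
    have hc : Continuous fun v : {v : Fin (n + 1) → ℝ // v ≠ 0} =>
        (A : Matrix (Fin (n + 1)) (Fin (n + 1)) ℝ).mulVec v.1 :=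
      continuous_const.matrix_mulVec continuous_subtype_val
    exact continuous_mk'.comp (hc.subtype_mk fun v => (mk_smul_mk A v.2).1)

/-- The nonzero vectors that represent the points of a subset of projective space. -/
def lift (Ω : Set (RPn n)) : Set (Fin (n + 1) → ℝ) :=
  {v | ∃ h : v ≠ 0, Projectivization.mk ℝ v h ∈ Ω}

lemma mem_lift {Ω : Set (RPn n)} {v : Fin (n + 1) → ℝ} (hv : v ≠ 0) :
    v ∈ lift Ω ↔ Projectivization.mk ℝ v hv ∈ Ω :=
  ⟨fun h => h.2, fun h => ⟨hv, h⟩⟩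

lemma coe_preimage_lift (Ω : Set (RPn n)) :
    (Subtype.val ⁻¹' lift Ω : Set {v : Fin (n + 1) → ℝ // v ≠ 0}) =
      Projectivization.mk' ℝ ⁻¹' Ω := by
  ext v
  exact mem_lift v.2

lemma smul_mem_lift {Ω : Set (RPn n)} {v : Fin (n + 1) → ℝ} {c : ℝ} (hc : c ≠ 0)
    (hv : v ∈ lift Ω) : c • v ∈ lift Ω := by
  obtain ⟨h, hv⟩ := hv
  refine ⟨smul_ne_zero hc h, ?_⟩
  rwa [(Projectivization.mk_eq_mk_iff' ℝ (c • v) v (smul_ne_zero hc h) h).2 ⟨c, rfl⟩]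

/-- Preimages under a continuous open map commute with closures. The origin is excluded because it
is a limit of every nonempty lift. -/
lemma mem_closure_lift {Ω : Set (RPn n)} {v : Fin (n + 1) → ℝ} (hv : v ≠ 0) :
    v ∈ closure (lift Ω) ↔ v ∈ lift (closure Ω) := by
  have h := isOpenMap_mk'.preimage_closure_eq_closure_preimage continuous_mk' Ω
  rw [← coe_preimage_lift, ← coe_preimage_lift,
    ← (isOpen_ne.isOpenMap_subtype_val).preimage_closure_eq_closure_preimage
      continuous_subtype_val] at h
  exact (Set.ext_iff.1 h ⟨v, hv⟩).symm

lemma interior_lift (Ω : Set (RPn n)) : interior (lift Ω) = lift (interior Ω) := by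
  have h := isOpenMap_mk'.preimage_interior_eq_interior_preimage continuous_mk' Ω
  rw [← coe_preimage_lift, ← coe_preimage_lift,
    ← (isOpen_ne.isOpenMap_subtype_val).preimage_interior_eq_interior_preimage
      continuous_subtype_val] at h
  ext v
  constructor
  · intro hv
    exact (Set.ext_iff.1 h ⟨v, (interior_subset hv).1⟩).2 hv
  · intro hv
    exact (Set.ext_iff.1 h ⟨v, hv.1⟩).1 hv

end RPn

/-! ### Cones over properly convex sets -/

namespace RPn

variable {n : ℕ}

/-- The cone of nonzero nonnegative combinations of `u` and `v` lies in `S`. -/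
def ConeJoined {E : Type*} [AddCommGroup E] [Module ℝ E] (S : Set E) (u v : E) : Prop :=
  ∀ s t : ℝ, 0 ≤ s → 0 ≤ t → 0 < s + t → s • u + t • v ∈ S

section ConeJoined

variable {E : Type*} [AddCommGroup E] [Module ℝ E] {S T : Set E} {u v : E}

lemma ConeJoined.mono (h : ConeJoined S u v) (hST : S ⊆ T) : ConeJoined T u v :=
  fun s t hs ht hst => hST (h s t hs ht hst)

lemma ConeJoined.smul_right (h : ConeJoined S u v) {c : ℝ} (hc : 0 < c) :
    ConeJoined S u (c • v) := fun s t hs ht hst => by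
  rw [smul_smul]
  refine h s (t * c) hs (by positivity) ?_
  rcases hs.lt_or_eq with h | rfl
  · positivity
  · have : 0 < t := by linarith
    positivity

lemma ConeJoined.segment_subset (h : ConeJoined S u v) : _root_.segment ℝ u v ⊆ S := by
  rintro _ ⟨s, t, hs, ht, hst, rfl⟩
  exact h s t hs ht (by linarith)

/-- If one of the two projective segments between `u` and `v` lies in `S` away from the origin, then
a segment avoiding the origin does. -/
lemma coneJoined_or_of_ne_zero (h0 : ∀ x ∈ S, x ≠ 0)
    (hS : ∀ x ∈ S, ∀ c : ℝ, c ≠ 0 → c • x ∈ S) (hu : u ∈ S) (hv : v ∈ S)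
    (h : (∀ s t : ℝ, 0 ≤ s → 0 ≤ t → s • u + t • v ≠ 0 → s • u + t • v ∈ S) ∨
      (∀ s t : ℝ, 0 ≤ s → 0 ≤ t → s • u + t • (-v) ≠ 0 → s • u + t • (-v) ∈ S)) :
    ConeJoined S u v ∨ ConeJoined S u (-v) := by
  by_cases hcol : ∃ c : ℝ, v = c • u
  · obtain ⟨c, rfl⟩ := hcol
    have hc : c ≠ 0 := by
      rintro rfl
      exact h0 _ hv (by simp)
    have key : ∀ d : ℝ, 0 < d → ConeJoined S u (d • u) := by
      intro d hd s t hs ht hst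
      rw [smul_smul, ← add_smul]
      refine hS u hu _ (ne_of_gt ?_)
      rcases hs.lt_or_eq with h | rfl
      · positivity
      · have : 0 < t := by linarith
        positivity
    rcases lt_or_gt_of_ne hc with hc | hc
    · right
      rw [← neg_smul]
      exact key _ (by linarith)
    · exact Or.inl (key _ hc)
  · have hne : ∀ s t : ℝ, s + t ≠ 0 ∨ s ≠ 0 → s • u + t • v ≠ 0 := by
      intro s t hst h
      rcases eq_or_ne t 0 with rfl | ht
      · have hs : s ≠ 0 := by simpa using hst
        exact h0 u hu ((smul_eq_zero.1 (by simpa using h)).resolve_left hs)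
      · refine hcol ⟨-(t⁻¹ * s), ?_⟩
        have h1 : t • v = -(s • u) := by rw [eq_neg_iff_add_eq_zero, add_comm]; exact h
        rw [neg_smul, mul_smul, ← smul_neg, ← h1, smul_smul, inv_mul_cancel₀ ht, one_smul]
    rcases h with h | h
    · exact Or.inl fun s t hs ht hst => h s t hs ht (hne s t (Or.inl hst.ne'))
    · refine Or.inr fun s t hs ht hst => h s t hs ht ?_
      rw [smul_neg, ← neg_smul]
      refine hne s (-t) ?_
      by_contra! hcon
      linarith [hcon.1, hcon.2]

end ConeJoined

lemma lift_mono {Ω Ω' : Set (RPn n)} (h : Ω ⊆ Ω') : lift Ω ⊆ lift Ω' :=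
  fun _ hv => ⟨hv.1, h hv.2⟩

/-- The signs relating `u`, `v` to the representatives supplied by convexity decide which of the two
segments is obtained. -/
lemma IsConvex.coneJoined {Ω : Set (RPn n)} (h : IsConvex Ω) {u v : Fin (n + 1) → ℝ}
    (hu : u ∈ lift Ω) (hv : v ∈ lift Ω) :
    ConeJoined (lift Ω) u v ∨ ConeJoined (lift Ω) u (-v) := by
  refine coneJoined_or_of_ne_zero (fun x hx => hx.1) (fun x hx c hc => smul_mem_lift hc hx) hu hv ?_
  obtain ⟨u', v', hu', hv', hpu, hpv, hseg⟩ := h _ hu.2 _ hv.2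
  obtain ⟨a, ha⟩ := (Projectivization.mk_eq_mk_iff' ℝ _ _ _ _).1 hpu
  obtain ⟨b, hb⟩ := (Projectivization.mk_eq_mk_iff' ℝ _ _ _ _).1 hpv
  have key : ∀ s t : ℝ, 0 ≤ s → 0 ≤ t → s • u' + t • v' ≠ 0 → s • u' + t • v' ∈ lift Ω :=
    fun s t hs ht hne => ⟨hne, hseg ⟨s, t, hne, hs, ht, rfl⟩⟩
  have key' : ∀ s t : ℝ, s ≤ 0 → t ≤ 0 → s • u' + t • v' ≠ 0 → s • u' + t • v' ∈ lift Ω := by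
    intro s t hs ht hne
    have e : s • u' + t • v' = (-1 : ℝ) • ((-s) • u' + (-t) • v') := by module
    rw [e] at hne ⊢
    exact smul_mem_lift (by norm_num) (key _ _ (by linarith) (by linarith)
      (fun h => hne (by rw [h, smul_zero])))
  rw [← ha, ← hb]
  rcases le_total 0 a with ha | ha <;> rcases le_total 0 b with hb | hb
  · left
    intro s t hs ht
    rw [smul_smul, smul_smul]
    exact key _ _ (mul_nonneg hs ha) (mul_nonneg ht hb)
  · right
    intro s t hs ht
    rw [← neg_smul, smul_smul, smul_smul]
    exact key _ _ (mul_nonneg hs ha) (mul_nonneg ht (by linarith))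
  · right
    intro s t hs ht
    rw [← neg_smul, smul_smul, smul_smul]
    exact key' _ _ (mul_nonpos_of_nonneg_of_nonpos hs ha)
      (mul_nonpos_of_nonneg_of_nonpos ht (by linarith))
  · left
    intro s t hs ht
    rw [smul_smul, smul_smul]
    exact key' _ _ (mul_nonpos_of_nonneg_of_nonpos hs ha) (mul_nonpos_of_nonneg_of_nonpos ht hb)

/-- Each alternative is a closed condition on the pair. Two closed sets covering `lift Ω ×ˢ lift Ω`
also cover its closure. -/
lemma IsConvex.coneJoined_closure {Ω : Set (RPn n)} (h : IsConvex Ω) {u v : Fin (n + 1) → ℝ}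
    (hu : u ∈ lift (closure Ω)) (hv : v ∈ lift (closure Ω)) :
    ConeJoined (lift (closure Ω)) u v ∨ ConeJoined (lift (closure Ω)) u (-v) := by
  refine coneJoined_or_of_ne_zero (fun x hx => hx.1) (fun x hx c hc => smul_mem_lift hc hx) hu hv ?_
  let P : Set ((Fin (n + 1) → ℝ) × (Fin (n + 1) → ℝ)) :=
    {p | ∀ s t : ℝ, 0 ≤ s → 0 ≤ t → s • p.1 + t • p.2 ∈ closure (lift Ω)}
  let N : Set ((Fin (n + 1) → ℝ) × (Fin (n + 1) → ℝ)) :=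
    {p | ∀ s t : ℝ, 0 ≤ s → 0 ≤ t → s • p.1 + t • (-p.2) ∈ closure (lift Ω)}
  have hP : IsClosed P := by
    simp only [P, Set.ofPred_forall]
    refine isClosed_iInter fun s => isClosed_iInter fun t => isClosed_iInter fun _ =>
      isClosed_iInter fun _ => isClosed_closure.preimage (by fun_prop)
  have hN : IsClosed N := by
    simp only [N, Set.ofPred_forall]
    refine isClosed_iInter fun s => isClosed_iInter fun t => isClosed_iInter fun _ =>
      isClosed_iInter fun _ => isClosed_closure.preimage (by fun_prop)
  have hz : ∀ x ∈ lift Ω, (0 : Fin (n + 1) → ℝ) ∈ closure (lift Ω) := by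
    intro x hx
    have h1 : Tendsto (fun c : ℝ => c • x) (𝓝[≠] 0) (𝓝 0) := by
      have : Tendsto (fun c : ℝ => c • x) (𝓝 0) (𝓝 ((0 : ℝ) • x)) :=
        (by fun_prop : Continuous fun c : ℝ => c • x).tendsto 0
      rw [zero_smul] at this
      exact this.mono_left nhdsWithin_le_nhds
    refine mem_closure_of_tendsto h1 ?_
    filter_upwards [self_mem_nhdsWithin] with c hc using smul_mem_lift hc hx
  have hsub : (lift Ω) ×ˢ (lift Ω) ⊆ P ∪ N := by
    rintro ⟨x, y⟩ ⟨hx, hy⟩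
    have hc : ∀ w, ConeJoined (lift Ω) x w → ∀ s t : ℝ, 0 ≤ s → 0 ≤ t →
        s • x + t • w ∈ closure (lift Ω) := by
      intro w hw s t hs ht
      rcases (add_nonneg hs ht).lt_or_eq with hst | hst
      · exact subset_closure (hw s t hs ht hst)
      · have h1 : s = 0 := by linarith
        have h2 : t = 0 := by linarith
        rw [h1, h2, zero_smul, zero_smul, add_zero]
        exact hz x hx
    exact (h.coneJoined hx hy).imp (hc y) (hc (-y))
  have hmem : (u, v) ∈ P ∪ N := by
    refine closure_minimal hsub (hP.union hN) ?_
    rw [closure_prod_eq]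
    exact ⟨(mem_closure_lift hu.1).2 hu, (mem_closure_lift hv.1).2 hv⟩
  exact hmem.imp (fun hm s t hs ht hne => (mem_closure_lift hne).1 (hm s t hs ht))
    (fun hm s t hs ht hne => (mem_closure_lift hne).1 (hm s t hs ht))

/-- Both segments together with their negatives fill the plane spanned by `u` and `v` apart from the
origin, which would put a whole projective line into the closure. -/
lemma IsProperlyConvex.not_coneJoined_neg {Ω : Set (RPn n)} (h : IsProperlyConvex Ω)
    {u v : Fin (n + 1) → ℝ} (h1 : ConeJoined (lift (closure Ω)) u v)
    (h2 : ConeJoined (lift (closure Ω)) u (-v)) : False := by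
  have hu : u ∈ lift (closure Ω) := by
    simpa using h1 1 0 zero_le_one le_rfl (by norm_num)
  have hne : ∀ a b : ℝ, (a ≠ 0 ∨ b ≠ 0) → a • u + b • v ∈ lift (closure Ω) := by
    intro a b hab
    have hpos : 0 < |a| + |b| := by
      rcases hab with h | h
      · have := abs_pos.2 h; positivity
      · have := abs_pos.2 h; positivity
    have e1 := h1 |a| |b| (abs_nonneg _) (abs_nonneg _) hpos
    have e2 := h2 |a| |b| (abs_nonneg _) (abs_nonneg _) hpos
    have e3 := smul_mem_lift (c := -1) (by norm_num) e1
    have e4 := smul_mem_lift (c := -1) (by norm_num) e2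
    rcases abs_choice a with ha | ha <;> rcases abs_choice b with hb | hb <;> rw [ha, hb] at e1 e2 e3 e4
    · exact e1
    · convert e2 using 1; module
    · convert e4 using 1; module
    · convert e3 using 1; module
  have hli : LinearIndependent ℝ ![u, v] := by
    rw [LinearIndependent.pair_iff]
    intro s t hst
    by_contra hcon
    exact (hne s t (by tauto)).1 hst
  have hfin : Module.finrank ℝ (Submodule.span ℝ (Set.range ![u, v])) = 2 := by
    rw [finrank_span_eq_card hli, Fintype.card_fin]
  refine h.2 _ hfin fun x hx => ?_
  have hrep : x.rep ∈ Submodule.span ℝ (Set.range ![u, v]) :=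
    hx (by rw [Projectivization.submodule_eq]; exact Submodule.mem_span_singleton_self _)
  rw [Matrix.range_cons, Matrix.range_cons, Matrix.range_empty, Set.union_empty,
    Set.singleton_union, Submodule.mem_span_pair] at hrep
  obtain ⟨a, b, hab⟩ := hrep
  have hmem : x.rep ∈ lift (closure Ω) := by
    rw [← hab]
    refine hne a b ?_
    by_contra! hcon
    apply x.rep_nonzero
    rw [← hab, hcon.1, hcon.2, zero_smul, zero_smul, add_zero]
  simpa [x.mk_rep] using hmem.2

/-- `K` is a closed salient convex cone with nonempty interior. -/
structure IsSalientCone {E : Type*} [TopologicalSpace E] [AddCommGroup E] [Module ℝ E]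
    (K : Set E) : Prop where
  isClosed : IsClosed K
  add_mem : ∀ x ∈ K, ∀ y ∈ K, x + y ∈ K
  smul_mem : ∀ x ∈ K, ∀ c : ℝ, 0 ≤ c → c • x ∈ K
  salient : ∀ x ∈ K, -x ∈ K → x = 0
  nonempty_interior : (interior K).Nonempty

/-- `K` is a closed salient convex cone with nonempty interior, and the points of the closure and of
the interior of `Ω` are the lines through the points of `K` and of the interior of `K`. -/
structure IsConeLift (Ω : Set (RPn n)) (K : Set (Fin (n + 1) → ℝ)) : Prop
    extends IsSalientCone K where
  mem_lift_closure : ∀ v, v ≠ 0 → (v ∈ lift (closure Ω) ↔ v ∈ K ∨ -v ∈ K)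
  mem_lift_interior : ∀ v, v ∈ lift (interior Ω) ↔ v ∈ interior K ∨ -v ∈ interior K

/-- Fix a vector `u` over an interior point. Every vector over the closure is joined to `u` by
exactly one of the two segments, and this choice of sign splits the lift of the closure into `K'`
and `-K'`. Both are closed away from the origin, so by connectedness no segment in the lift passes
from one to the other. This makes the part of `lift Ω` in `K'` convex, and its closure is the
required cone. -/
lemma IsProperlyConvex.exists_isConeLift {Ω : Set (RPn n)} (h : IsProperlyConvex Ω)
    (hdim : HasFullDim Ω) : ∃ K, IsConeLift Ω K := by
  obtain ⟨p, hp⟩ := hdim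
  set C := lift (closure Ω) with hC
  have hΩC : lift Ω ⊆ C := lift_mono subset_closure
  let u := p.rep
  have hu : u ∈ interior (lift Ω) := by
    rw [interior_lift]
    exact ⟨p.rep_nonzero, by rwa [p.mk_rep]⟩
  have huΩ : u ∈ lift Ω := interior_subset hu
  have huC : u ∈ C := hΩC huΩ
  have hCscale : ∀ x ∈ C, ∀ c : ℝ, c ≠ 0 → c • x ∈ C := fun x hx c hc => smul_mem_lift hc hx
  have hCneg : ∀ x ∈ C, -x ∈ C := fun x hx => by
    simpa using hCscale x hx (-1) (by norm_num)
  have hCcl : ∀ x ∈ closure C, x ≠ 0 → x ∈ C := by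
    intro x hx hx0
    have := (mem_closure_lift hx0).1 hx
    rwa [closure_closure] at this
  have hor : ∀ v ∈ C, ∀ w ∈ C, ConeJoined C v w ∨ ConeJoined C v (-w) :=
    fun v hv w hw => h.1.coneJoined_closure hv hw
  have hnot : ∀ v w, ConeJoined C v w → ConeJoined C v (-w) → False :=
    fun v w h1 h2 => h.not_coneJoined_neg h1 h2
  let K' : Set (Fin (n + 1) → ℝ) := {v | v ∈ C ∧ ConeJoined C u v}
  have hcover : ∀ v ∈ C, v ∈ K' ∨ -v ∈ K' := fun v hv =>
    (hor u huC v hv).imp (fun h => ⟨hv, h⟩) (fun h => ⟨hCneg v hv, h⟩)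
  have hdisj : ∀ v, v ∈ K' → -v ∈ K' → False := fun v h1 h2 => hnot u v h1.2 h2.2
  have hscale : ∀ v ∈ K', ∀ c : ℝ, 0 < c → c • v ∈ K' := fun v hv c hc =>
    ⟨hCscale v hv.1 c hc.ne', hv.2.smul_right hc⟩
  have hclosed : ∀ v ∈ closure K', v ≠ 0 → v ∈ K' := by
    intro v hv hv0
    have hvC : v ∈ C := hCcl v (closure_mono (fun x hx => hx.1) hv) hv0
    refine ⟨hvC, fun s t hs ht hst => ?_⟩
    have hmem : s • u + t • v ∈ closure C := by
      have hcont : Continuous fun x : Fin (n + 1) → ℝ => s • u + t • x := by fun_prop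
      exact map_mem_closure (f := fun x => s • u + t • x) hcont hv
        fun x (hx : x ∈ K') => hx.2 s t hs ht hst
    -- The only danger is that `v` is a negative multiple of `u`. Then some `x ∈ K'` near `v` has a
    -- negative multiple in a ball around `u` inside `lift Ω`. Convexity of the ball joins `u` to
    -- `-x` as well, against uniqueness.
    refine hCcl _ hmem fun hzero => ?_
    have ht0 : t ≠ 0 := by
      rintro rfl
      have hs0 : s ≠ 0 := by linarith
      exact huC.1 ((smul_eq_zero.1 (by simpa using hzero)).resolve_left hs0)
    have htpos : 0 < t := lt_of_le_of_ne ht ht0.symm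
    have hspos : 0 < s := by
      refine lt_of_le_of_ne hs fun hs0 => ?_
      rw [← hs0, zero_smul, zero_add] at hzero
      exact hv0 ((smul_eq_zero.1 hzero).resolve_left ht0)
    have huv : (-(t / s)) • v = u := by
      have h1 : s • u = -(t • v) := eq_neg_iff_add_eq_zero.2 hzero
      calc (-(t / s)) • v = s⁻¹ • (-(t • v)) := by
            rw [← neg_smul, smul_smul]; congr 1; field_simp
        _ = u := by rw [← h1, smul_smul, inv_mul_cancel₀ hspos.ne', one_smul]
    obtain ⟨ε, hε, hball⟩ := Metric.mem_nhds_iff.1 (mem_interior_iff_mem_nhds.1 hu)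
    have hcont : Continuous fun x : Fin (n + 1) → ℝ => (-(t / s)) • x := by fun_prop
    have hnhds : {x : Fin (n + 1) → ℝ | (-(t / s)) • x ∈ Metric.ball u ε} ∈ 𝓝 v :=
      hcont.continuousAt (by rw [huv]; exact Metric.ball_mem_nhds u hε)
    obtain ⟨x, hxb, hx⟩ := mem_closure_iff_nhds.1 hv _ hnhds
    have hjoin : ConeJoined C u ((-(t / s)) • x) := by
      intro a b ha hb hab
      have hconv := (convex_ball u ε) (Metric.mem_ball_self hε) hxb
        (div_nonneg ha hab.le) (div_nonneg hb hab.le) (by field_simp)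
      have h2 := hCscale _ (hΩC (hball hconv)) (a + b) hab.ne'
      convert h2 using 1
      rw [smul_add, smul_smul (a + b), smul_smul (a + b), mul_div_cancel₀ _ hab.ne',
        mul_div_cancel₀ _ hab.ne']
    have := hjoin.smul_right (div_pos hspos htpos)
    rw [smul_smul, show s / t * -(t / s) = -1 by field_simp, neg_one_smul] at this
    exact hnot u x hx.2 this
  have hpath : ∀ v w, v ∈ K' → _root_.segment ℝ v w ⊆ C → w ∈ K' := by
    intro v w hv hseg
    by_contra hw
    have hwC := hseg (right_mem_segment ℝ v w)
    have hw' : -w ∈ K' := (hcover w hwC).resolve_left hw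
    obtain ⟨x, hx, hxA, hxB⟩ := isPreconnected_closed_iff.1 (convex_segment v w).isPreconnected
      (closure K') ((fun x => -x) ⁻¹' closure K') isClosed_closure
      (isClosed_closure.preimage continuous_neg)
      (fun x hx => (hcover x (hseg hx)).imp (fun h => subset_closure h) (fun h => subset_closure h))
      ⟨v, left_mem_segment ℝ v w, subset_closure hv⟩
      ⟨w, right_mem_segment ℝ v w, subset_closure hw'⟩
    have hx0 : x ≠ 0 := (hseg hx).1
    exact hdisj x (hclosed x hxA hx0) (hclosed _ hxB (neg_ne_zero.2 hx0))
  have hjoin : ∀ v ∈ K', ∀ w ∈ K', ¬ ConeJoined C v (-w) := fun v hv w hw hvw =>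
    hdisj w hw (hpath v (-w) hv hvw.segment_subset)
  have hin : ∀ v w, v ∈ K' → ConeJoined C v w → ConeJoined K' v w := by
    intro v w hv hvw s t hs ht hst
    refine hpath v _ hv ?_
    rintro _ ⟨a, b, ha, hb, hab, rfl⟩
    rw [smul_add, smul_smul, smul_smul, ← add_assoc, ← add_smul]
    refine hvw _ _ (by positivity) (by positivity) ?_
    rcases ha.lt_or_eq with h | rfl
    · positivity
    · have : b = 1 := by linarith
      subst this
      linarith
  -- `K'` sees only the closure of `Ω`. Working with `Q` retains the interior: a convex set with
  -- interior points has the same interior as its closure.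
  let Q : Set (Fin (n + 1) → ℝ) := lift Ω ∩ K'
  have hQ : ∀ v ∈ Q, ∀ w ∈ Q, ConeJoined Q v w := by
    intro v hv w hw
    have hΩ : ConeJoined (lift Ω) v w := (h.1.coneJoined hv.1 hw.1).resolve_right fun h =>
      hjoin v hv.2 w hw.2 (h.mono hΩC)
    intro s t hs ht hst
    exact ⟨hΩ s t hs ht hst, hin v w hv.2 (hΩ.mono hΩC) s t hs ht hst⟩
  have huK : u ∈ K' := by
    refine ⟨huC, fun s t hs ht hst => ?_⟩
    rw [← add_smul]
    exact hCscale u huC _ hst.ne'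
  have hnotcl : ∀ v ∈ K', v ∈ ((fun x => -x) ⁻¹' closure K')ᶜ := fun v hv hv' =>
    hdisj v hv (hclosed _ hv' (neg_ne_zero.2 hv.1.1))
  have hopen : IsOpen (((fun x : Fin (n + 1) → ℝ => -x) ⁻¹' closure K')ᶜ) :=
    (isClosed_closure.preimage continuous_neg).isOpen_compl
  have hsubQ : ((fun x : Fin (n + 1) → ℝ => -x) ⁻¹' closure K')ᶜ ∩ lift Ω ⊆ Q := by
    rintro x ⟨hx1, hx2⟩
    exact ⟨hx2, (hcover x (hΩC hx2)).resolve_right fun h => hx1 (subset_closure h)⟩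
  -- A point of `K'` has a neighbourhood missing `-K'`, and the points of `lift Ω` in that
  -- neighbourhood lie in `Q`.
  have hK'Q : K' ⊆ closure Q := fun x hx =>
    closure_mono hsubQ (hopen.inter_closure ⟨hnotcl x hx, (mem_closure_lift hx.1.1).2 hx.1⟩)
  have hQK' : ∀ x ∈ closure Q, x ≠ 0 → x ∈ K' := fun x hx hx0 =>
    hclosed x (closure_mono Set.inter_subset_right hx) hx0
  have hintQ : ∀ v, v ∈ interior (lift Ω) → v ∈ K' → v ∈ interior Q := by
    intro v hv hvK
    refine interior_mono hsubQ ?_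
    rw [interior_inter, hopen.interior_eq]
    exact ⟨hnotcl v hvK, hv⟩
  have hQconv : Convex ℝ Q := by
    intro x hx y hy a b ha hb hab
    exact hQ x hx y hy a b ha hb (by linarith)
  have hQint : interior (closure Q) = interior Q :=
    hQconv.interior_closure_eq_interior_of_nonempty_interior ⟨u, hintQ u hu huK⟩
  have hzero : (0 : Fin (n + 1) → ℝ) ∈ closure Q := by
    rw [← closure_closure]
    have h1 : Tendsto (fun c : ℝ => c • u) (𝓝[>] 0) (𝓝 0) := by
      have : Tendsto (fun c : ℝ => c • u) (𝓝 0) (𝓝 ((0 : ℝ) • u)) :=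
        (by fun_prop : Continuous fun c : ℝ => c • u).tendsto 0
      rw [zero_smul] at this
      exact this.mono_left nhdsWithin_le_nhds
    refine mem_closure_of_tendsto h1 ?_
    filter_upwards [self_mem_nhdsWithin] with c hc using hK'Q (hscale u huK c hc)
  refine ⟨closure Q, ⟨isClosed_closure, ?_, ?_, ?_, ?_⟩, ?_, ?_⟩
  · intro x hx y hy
    exact map_mem_closure₂ continuous_add hx hy fun a ha b hb => by
      simpa using hQ a ha b hb 1 1 zero_le_one zero_le_one (by norm_num)
  · intro x hx c hc
    rcases hc.lt_or_eq with hc | rfl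
    · exact map_mem_closure (by fun_prop : Continuous fun y : Fin (n + 1) → ℝ => c • y) hx
        fun y hy => ⟨smul_mem_lift hc.ne' hy.1, hscale y hy.2 c hc⟩
    · rwa [zero_smul]
  · intro x hx hx'
    by_contra hx0
    exact hdisj x (hQK' x hx hx0) (hQK' _ hx' (neg_ne_zero.2 hx0))
  · rw [hQint]
    exact ⟨u, hintQ u hu huK⟩
  · intro v hv0
    constructor
    · intro hv
      exact (hcover v hv).imp (fun h => hK'Q h) (fun h => hK'Q h)
    · rintro (hv | hv)
      · exact (hQK' v hv hv0).1
      · simpa using hCneg _ (hQK' _ hv (neg_ne_zero.2 hv0)).1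
  · intro v
    rw [hQint, ← interior_lift]
    have hneg : ∀ v, v ∈ interior (lift Ω) → -v ∈ interior (lift Ω) := by
      intro v hv
      rw [interior_lift] at hv ⊢
      simpa using smul_mem_lift (c := -1) (by norm_num) hv
    constructor
    · intro hv
      exact (hcover v (hΩC (interior_subset hv))).imp (hintQ v hv) (hintQ _ (hneg v hv))
    · rintro (hv | hv)
      · exact interior_mono Set.inter_subset_left hv
      · simpa using hneg _ (interior_mono Set.inter_subset_left hv)

end RPn

/-! ### Frames of maximal determinant and the normalization of cones -/

/-- A compact spanning set contains a frame in which all its points have coordinates of absolute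
value at most one. -/
lemma IsCompact.exists_frame {m : Type*} [Fintype m] [DecidableEq m] {S : Set (m → ℝ)}
    (hS : IsCompact S) (hspan : Submodule.span ℝ S = ⊤) :
    ∃ P : Matrix.GeneralLinearGroup m ℝ, (∀ i, (P : Matrix m m ℝ).row i ∈ S) ∧
      ∀ x ∈ S, ∃ t : m → ℝ, (∀ i, |t i| ≤ 1) ∧ x = Matrix.vecMul t (P : Matrix m m ℝ) := by
  have hP₀ : ∃ P₀ : Matrix m m ℝ, (∀ i, P₀ i ∈ S) ∧ P₀.det ≠ 0 := by
    obtain ⟨b, hbS, hbspan, hli⟩ := exists_linearIndependent ℝ S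
    let e := (Module.Basis.mk hli (by rw [Subtype.range_coe, hbspan, hspan])).indexEquiv
      (Pi.basisFun ℝ m)
    refine ⟨Matrix.of fun i => (e.symm i : m → ℝ), fun i => hbS (e.symm i).2, ?_⟩
    have h1 : LinearIndependent ℝ (Matrix.of fun i => (e.symm i : m → ℝ)).row :=
      hli.comp _ e.symm.injective
    exact ((Matrix.isUnit_iff_isUnit_det _).1
      (Matrix.linearIndependent_rows_iff_isUnit.1 h1)).ne_zero
  obtain ⟨P₀, hP₀S, hP₀det⟩ := hP₀
  -- Auerbach's argument: maximize the absolute determinant over frames in `S`. By Cramer's rule a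
  -- coordinate of `x` is the quotient by this determinant of the one with `x` replacing a row,
  -- hence at most one in absolute value.
  obtain ⟨P, hPS, hPmax⟩ := (isCompact_univ_pi fun _ : m => hS).exists_isMaxOn
    (f := fun P : m → m → ℝ => |(Matrix.of P).det|) ⟨P₀, fun i _ => hP₀S i⟩
    (Continuous.continuousOn
      (continuous_abs.comp (Continuous.matrix_det (continuous_id : Continuous fun P : m → m → ℝ => P))))
  have hdet : 0 < |(Matrix.of P).det| :=
    (abs_pos.2 hP₀det).trans_le (hPmax (fun i _ => hP₀S i))
  have hdet0 : (Matrix.of P).det ≠ 0 := abs_pos.1 hdet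
  refine ⟨Matrix.nonsingInvUnit (Matrix.of P) (isUnit_iff_ne_zero.2 hdet0),
    fun i => hPS i (Set.mem_univ i), fun x hx => ?_⟩
  refine ⟨fun i => ((Matrix.of P).updateRow i x).det / (Matrix.of P).det, fun i => ?_, ?_⟩
  · rw [abs_div, div_le_one hdet]
    have hmem : (Matrix.of P).updateRow i x ∈ Set.univ.pi fun _ : m => S := by
      intro j _
      by_cases hij : j = i
      · subst hij
        rwa [Matrix.updateRow_self]
      · rw [Matrix.updateRow_ne hij]
        exact hPS j (Set.mem_univ j)
    exact hPmax hmem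
  · have h1 := Matrix.mulVec_cramer (Matrix.of P).transpose x
    rw [Matrix.det_transpose, Matrix.mulVec_transpose] at h1
    have h2 : (fun i => ((Matrix.of P).updateRow i x).det / (Matrix.of P).det) =
        (Matrix.of P).det⁻¹ • Matrix.cramer (Matrix.of P).transpose x := by
      ext i
      rw [Pi.smul_apply, Matrix.cramer_transpose_apply, smul_eq_mul]
      ring
    rw [h2]
    change x = Matrix.vecMul _ (Matrix.of P)
    rw [Matrix.smul_vecMul, h1, smul_smul, inv_mul_cancel₀ hdet0, one_smul]

namespace RPn

variable {m : Type*}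

lemma IsSalientCone.zero_mem {E : Type*} [TopologicalSpace E] [AddCommGroup E] [Module ℝ E]
    {K : Set E} (h : IsSalientCone K) : (0 : E) ∈ K := by
  obtain ⟨x, hx⟩ := h.nonempty_interior
  simpa using h.smul_mem x (interior_subset hx) 0 le_rfl

lemma IsSalientCone.sum_mem {E ι : Type*} [TopologicalSpace E] [AddCommGroup E] [Module ℝ E]
    {K : Set E} (h : IsSalientCone K) (s : Finset ι) (f : ι → E) (hf : ∀ i ∈ s, f i ∈ K) :
    ∑ i ∈ s, f i ∈ K :=
  Finset.sum_induction f (· ∈ K) (fun x y hx hy => h.add_mem x hx y hy) h.zero_mem hf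

lemma IsSalientCone.span_eq_top {K : Set (m → ℝ)} [Fintype m] (h : IsSalientCone K) :
    Submodule.span ℝ K = ⊤ := by
  refine (Submodule.span ℝ K).eq_top_of_nonempty_interior' ?_
  exact h.nonempty_interior.mono (interior_mono Submodule.subset_span)

/-- The functionals that are nonnegative on `K`, identified with vectors. -/
def dualCone [Fintype m] (K : Set (m → ℝ)) : Set (m → ℝ) := {w | ∀ x ∈ K, 0 ≤ w ⬝ᵥ x}

lemma IsSalientCone.exists_dualCone_lt {K : Set (m → ℝ)} [Fintype m] [DecidableEq m]
    (h : IsSalientCone K) {x : m → ℝ} (hx : x ∉ K) : ∃ w ∈ dualCone K, w ⬝ᵥ x < 0 := by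
  let C : ProperCone ℝ (m → ℝ) :=
    { carrier := K
      add_mem' := fun {a b} ha hb => h.add_mem a ha b hb
      zero_mem' := h.zero_mem
      smul_mem' := fun c x hx => h.smul_mem x hx c.1 c.2
      isClosed' := h.isClosed }
  obtain ⟨f, hf, hfx⟩ := ProperCone.hyperplane_separation_point C (x₀ := x) hx
  have hdot : ∀ y, (fun i => f (Pi.single i 1)) ⬝ᵥ y = f y := by
    intro y
    conv_rhs => rw [← Finset.univ_sum_single y]
    rw [map_sum, dotProduct]
    refine Finset.sum_congr rfl fun i _ => ?_
    have : (Pi.single i (y i) : m → ℝ) = y i • Pi.single i 1 := by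
      rw [← Pi.single_smul, smul_eq_mul, mul_one]
    rw [this, map_smul, smul_eq_mul, mul_comm]
  exact ⟨_, fun y hy => by rw [hdot]; exact hf y hy, by rw [hdot]; exact hfx⟩

lemma isClosed_dualCone [Fintype m] (K : Set (m → ℝ)) : IsClosed (dualCone K) := by
  simp only [dualCone, Set.ofPred_forall]
  exact isClosed_iInter fun x => isClosed_iInter fun _ =>
    isClosed_le continuous_const (Continuous.dotProduct continuous_id continuous_const)

lemma smul_mem_dualCone [Fintype m] {K : Set (m → ℝ)} {w : m → ℝ} (hw : w ∈ dualCone K) {c : ℝ}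
    (hc : 0 ≤ c) : c • w ∈ dualCone K := fun x hx => by
  rw [smul_dotProduct]
  exact mul_nonneg hc (hw x hx)

/-- Otherwise a nonzero vector is annihilated by the dual cone. By separation both it and its
negative lie in `K`, contradicting salience. -/
lemma IsSalientCone.span_dualCone {K : Set (m → ℝ)} [Fintype m] [DecidableEq m]
    (h : IsSalientCone K) :
    Submodule.span ℝ (dualCone K ∩ Metric.closedBall 0 1) = ⊤ := by
  by_contra hne
  obtain ⟨f, hf0, hf⟩ := Submodule.exists_le_ker_of_lt_top _ (lt_top_iff_ne_top.2 hne)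
  have hdot : ∀ y, y ⬝ᵥ (fun i => f (Pi.single i 1)) = f y := by
    intro y
    conv_rhs => rw [← Finset.univ_sum_single y]
    rw [map_sum, dotProduct]
    refine Finset.sum_congr rfl fun i _ => ?_
    have : (Pi.single i (y i) : m → ℝ) = y i • Pi.single i 1 := by
      rw [← Pi.single_smul, smul_eq_mul, mul_one]
    rw [this, map_smul, smul_eq_mul]
  have hvan : ∀ w ∈ dualCone K, w ⬝ᵥ (fun i => f (Pi.single i 1)) = 0 := by
    intro w hw
    rcases eq_or_ne w 0 with rfl | hw0
    · rw [zero_dotProduct]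
    have hn := norm_pos_iff.2 hw0
    have hmem : ‖w‖⁻¹ • w ∈ Submodule.span ℝ (dualCone K ∩ Metric.closedBall 0 1) := by
      refine Submodule.subset_span ⟨smul_mem_dualCone hw (by positivity), ?_⟩
      rw [mem_closedBall_zero_iff, norm_smul, norm_inv, norm_norm, inv_mul_cancel₀ hn.ne']
    have h1 := LinearMap.mem_ker.1 (hf hmem)
    rw [map_smul, smul_eq_mul] at h1
    rw [hdot]
    exact (mul_eq_zero.1 h1).resolve_left (inv_ne_zero hn.ne')
  have hx : (fun i => f (Pi.single i 1)) ∈ K := by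
    by_contra hx
    obtain ⟨w, hw, hlt⟩ := h.exists_dualCone_lt hx
    exact hlt.ne (hvan w hw)
  have hx' : -(fun i => f (Pi.single i 1)) ∈ K := by
    by_contra hx
    obtain ⟨w, hw, hlt⟩ := h.exists_dualCone_lt hx
    rw [dotProduct_neg, hvan w hw, neg_zero] at hlt
    exact lt_irrefl _ hlt
  have hzero := h.salient _ hx hx'
  exact hf0 (LinearMap.ext fun y => by rw [← hdot, hzero, dotProduct_zero]; rfl)

/-- A salient cone can be moved by a linear map to one between the nonnegative orthant and a fixed
salient cone, in such a way that conjugation by this map keeps the linear maps preserving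
the cone bounded. -/
lemma IsSalientCone.exists_normalization {K : Set (m → ℝ)} [Fintype m] [DecidableEq m]
    (h : IsSalientCone K) : ∃ B : Matrix.GeneralLinearGroup m ℝ,
      (∀ t : m → ℝ, (∀ i, 0 ≤ t i) →
        ((B⁻¹ : Matrix.GeneralLinearGroup m ℝ) : Matrix m m ℝ).mulVec t ∈ K) ∧
      (∀ x ∈ K, ∀ i, |(B : Matrix m m ℝ).mulVec x i| ≤ ∑ j, (B : Matrix m m ℝ).mulVec x j) ∧
      ∀ (A : Matrix m m ℝ) (M : ℝ), 0 < M → (∀ i j, |A i j| ≤ M) →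
        (∀ x ∈ K, A.mulVec x ∈ K) →
        ∀ i j, |((B : Matrix m m ℝ) * A *
          ((B⁻¹ : Matrix.GeneralLinearGroup m ℝ) : Matrix m m ℝ)) i j| ≤
            Fintype.card m ^ 2 * M := by
  obtain ⟨W, hW, hWframe⟩ := IsCompact.exists_frame
    ((isCompact_closedBall (0 : m → ℝ) 1).inter_left (isClosed_dualCone K)) h.span_dualCone
  have hWdot : ∀ x i, (W : Matrix m m ℝ).mulVec x i = (W : Matrix m m ℝ).row i ⬝ᵥ x :=
    fun x i => rfl
  have hWnonneg : ∀ x ∈ K, ∀ i, 0 ≤ (W : Matrix m m ℝ).mulVec x i := fun x hx i =>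
    (hW i).1 x hx
  -- The rows of `W` are independent functionals nonnegative on `K`, so their sum is positive on `K`
  -- away from zero and cuts it in a compact slice.
  let f : (m → ℝ) →ₗ[ℝ] ℝ := ∑ i, LinearMap.proj i ∘ₗ (W : Matrix m m ℝ).mulVecLin
  have hf : ∀ x, f x = ∑ i, (W : Matrix m m ℝ).mulVec x i := fun x => by
    simp [f]
  have hfcont : Continuous f := f.continuous_of_finiteDimensional
  have hWle : ∀ x ∈ K, ∀ i, (W : Matrix m m ℝ).mulVec x i ≤ f x := fun x hx i => by
    rw [hf]
    exact Finset.single_le_sum (f := fun i => (W : Matrix m m ℝ).mulVec x i)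
      (fun j _ => hWnonneg x hx j) (Finset.mem_univ i)
  have hfnonneg : ∀ x ∈ K, 0 ≤ f x := fun x hx => by
    rw [hf]; exact Finset.sum_nonneg fun j _ => hWnonneg x hx j
  have hinvW : ∀ x, ((W⁻¹ : Matrix.GeneralLinearGroup m ℝ) : Matrix m m ℝ).mulVec
      ((W : Matrix m m ℝ).mulVec x) = x := fun x => by
    rw [Matrix.mulVec_mulVec, ← Units.val_mul, inv_mul_cancel, Units.val_one, Matrix.one_mulVec]
  have hfpos : ∀ x ∈ K, x ≠ 0 → 0 < f x := by
    intro x hx hx0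
    refine lt_of_le_of_ne (hfnonneg x hx) fun hf0 => hx0 ?_
    rw [← hinvW x]
    have : (W : Matrix m m ℝ).mulVec x = 0 := by
      ext i
      exact le_antisymm ((hWle x hx i).trans hf0.symm.le) (hWnonneg x hx i)
    rw [this, Matrix.mulVec_zero]
  -- Composing a row of `W` with `A` gives a dual functional of sup norm at most `card m * M`. After
  -- rescaling it is a combination of the rows with coefficients at most one, so on `K` it is
  -- bounded by `card m * M * f`. Summing over the rows gives the second factor `card m`.
  have hfA : ∀ (A : Matrix m m ℝ) (M : ℝ), 0 < M → (∀ i j, |A i j| ≤ M) →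
      (∀ x ∈ K, A.mulVec x ∈ K) → ∀ x ∈ K, f (A.mulVec x) ≤ Fintype.card m ^ 2 * M * f x := by
    intro A M hM hAM hAK x hx
    have hrow : ∀ i, (W : Matrix m m ℝ).mulVec (A.mulVec x) i ≤ Fintype.card m * M * f x := by
      intro i
      rcases isEmpty_or_nonempty m with hm | hm
      · exact hm.elim i
      have hcard : (0 : ℝ) < Fintype.card m := by exact_mod_cast Fintype.card_pos
      set w := Matrix.vecMul ((W : Matrix m m ℝ).row i) A with hw
      have hwx : ∀ y, w ⬝ᵥ y = (W : Matrix m m ℝ).mulVec (A.mulVec y) i := fun y => by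
        rw [hw, ← Matrix.dotProduct_mulVec]; rfl
      have hwd : w ∈ dualCone K := fun y hy => by
        rw [hwx]; exact hWnonneg _ (hAK y hy) i
      have hwn : ‖w‖ ≤ Fintype.card m * M := by
        refine (pi_norm_le_iff_of_nonneg (by positivity)).2 fun j => ?_
        rw [hw, Matrix.vecMul, dotProduct, Real.norm_eq_abs]
        refine (Finset.abs_sum_le_sum_abs _ _).trans ?_
        rw [← nsmul_eq_mul, ← Finset.card_univ]
        refine Finset.sum_le_card_nsmul _ _ _ fun k _ => ?_
        rw [abs_mul]
        have h1 : |(W : Matrix m m ℝ).row i k| ≤ 1 :=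
          (norm_le_pi_norm _ k).trans (mem_closedBall_zero_iff.1 (hW i).2)
        calc _ ≤ 1 * M := mul_le_mul h1 (hAM k j) (abs_nonneg _) zero_le_one
          _ = M := one_mul M
      have hc : 0 < Fintype.card m * M := by positivity
      obtain ⟨t, ht, hwt⟩ := hWframe ((Fintype.card m * M)⁻¹ • w)
        ⟨smul_mem_dualCone hwd (by positivity), by
          rw [mem_closedBall_zero_iff, norm_smul, norm_inv, Real.norm_of_nonneg hc.le]
          exact (inv_mul_le_one₀ hc).2 hwn⟩
      have h1 : (Fintype.card m * M)⁻¹ * (w ⬝ᵥ x) ≤ f x := by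
        rw [← smul_eq_mul, ← smul_dotProduct, hwt, ← Matrix.dotProduct_mulVec, hf, dotProduct]
        refine Finset.sum_le_sum fun j _ => ?_
        calc t j * (W : Matrix m m ℝ).mulVec x j ≤ 1 * (W : Matrix m m ℝ).mulVec x j :=
              mul_le_mul_of_nonneg_right ((le_abs_self _).trans (ht j)) (hWnonneg x hx j)
          _ = _ := one_mul _
      rw [← hwx]
      rwa [inv_mul_le_iff₀ hc] at h1
    rw [hf]
    calc ∑ i, (W : Matrix m m ℝ).mulVec (A.mulVec x) i
        ≤ Finset.univ.card (α := m) • (Fintype.card m * M * f x) :=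
          Finset.sum_le_card_nsmul _ _ _ fun i _ => hrow i
      _ = Fintype.card m ^ 2 * M * f x := by
          rw [nsmul_eq_mul, Finset.card_univ]; ring
  have hSclosed : IsClosed (K ∩ f ⁻¹' {1}) := h.isClosed.inter (isClosed_singleton.preimage hfcont)
  have hScompact : IsCompact (K ∩ f ⁻¹' {1}) := by
    have hc : IsCompact ((fun y => ((W⁻¹ : Matrix.GeneralLinearGroup m ℝ) :
        Matrix m m ℝ).mulVec y) '' Set.Icc (0 : m → ℝ) 1) :=
      isCompact_Icc.image (Continuous.matrix_mulVec continuous_const continuous_id)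
    refine hc.of_isClosed_subset hSclosed fun x hx => ?_
    refine ⟨(W : Matrix m m ℝ).mulVec x, ⟨fun i => hWnonneg x hx.1 i, fun i => ?_⟩, hinvW x⟩
    exact (hWle x hx.1 i).trans (le_of_eq hx.2)
  have hSspan : Submodule.span ℝ (K ∩ f ⁻¹' {1}) = ⊤ := by
    rw [eq_top_iff, ← h.span_eq_top, Submodule.span_le]
    intro x hx
    rcases eq_or_ne x 0 with rfl | hx0
    · exact Submodule.zero_mem _
    have hfx := hfpos x hx hx0
    have hmem : (f x)⁻¹ • x ∈ Submodule.span ℝ (K ∩ f ⁻¹' {1}) := by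
      refine Submodule.subset_span ⟨h.smul_mem x hx _ (by positivity), ?_⟩
      rw [Set.mem_preimage, map_smul, smul_eq_mul, inv_mul_cancel₀ hfx.ne']
      rfl
    have := Submodule.smul_mem _ (f x) hmem
    rwa [smul_smul, mul_inv_cancel₀ hfx.ne', one_smul] at this
  obtain ⟨P, hP, hPframe⟩ := hScompact.exists_frame hSspan
  -- The columns of `B'` are the second frame, taken in the slice `f = 1`. Hence `f` becomes the sum
  -- of the coordinates, and the frame property bounds each coordinate of a point of `K` by `f`.
  let B' : Matrix.GeneralLinearGroup m ℝ :=
    ⟨(P : Matrix m m ℝ).transpose,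
      ((P⁻¹ : Matrix.GeneralLinearGroup m ℝ) : Matrix m m ℝ).transpose,
      by rw [← Matrix.transpose_mul, ← Units.val_mul, inv_mul_cancel, Units.val_one,
        Matrix.transpose_one],
      by rw [← Matrix.transpose_mul, ← Units.val_mul, mul_inv_cancel, Units.val_one,
        Matrix.transpose_one]⟩
  have hB'vec : ∀ t, (B' : Matrix m m ℝ).mulVec t = Matrix.vecMul t (P : Matrix m m ℝ) :=
    fun t => Matrix.mulVec_transpose _ _
  have hB'sum : ∀ t, (B' : Matrix m m ℝ).mulVec t = ∑ i, t i • (P : Matrix m m ℝ).row i :=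
    fun t => by rw [hB'vec, Matrix.vecMul_eq_sum]; rfl
  have hinvB : ∀ t, ((B'⁻¹ : Matrix.GeneralLinearGroup m ℝ) : Matrix m m ℝ).mulVec
      ((B' : Matrix m m ℝ).mulVec t) = t := fun t => by
    rw [Matrix.mulVec_mulVec, ← Units.val_mul, inv_mul_cancel, Units.val_one, Matrix.one_mulVec]
  have hfB : ∀ t, f ((B' : Matrix m m ℝ).mulVec t) = ∑ i, t i := fun t => by
    rw [hB'sum, map_sum]
    refine Finset.sum_congr rfl fun i _ => ?_
    rw [map_smul, (hP i).2, smul_eq_mul, mul_one]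
  have hbound : ∀ x ∈ K, ∀ i, |((B'⁻¹ : Matrix.GeneralLinearGroup m ℝ) :
      Matrix m m ℝ).mulVec x i| ≤ f x := by
    intro x hx i
    rcases eq_or_ne x 0 with rfl | hx0
    · simp [Matrix.mulVec_zero]
    have hfx := hfpos x hx hx0
    obtain ⟨t, ht, hxt⟩ := hPframe ((f x)⁻¹ • x) ⟨h.smul_mem x hx _ (by positivity), by
      rw [Set.mem_preimage, map_smul, smul_eq_mul, inv_mul_cancel₀ hfx.ne']
      rfl⟩
    have hx' : x = (B' : Matrix m m ℝ).mulVec (f x • t) := by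
      rw [Matrix.mulVec_smul, hB'vec, ← hxt, smul_smul, mul_inv_cancel₀ hfx.ne', one_smul]
    have hval : ((B'⁻¹ : Matrix.GeneralLinearGroup m ℝ) : Matrix m m ℝ).mulVec x = f x • t := by
      conv_lhs => rw [hx']
      exact hinvB _
    rw [hval, Pi.smul_apply, smul_eq_mul, abs_mul, abs_of_pos hfx]
    exact mul_le_of_le_one_right hfx.le (ht i)
  refine ⟨B'⁻¹, ?_, ?_, ?_⟩
  · intro t ht
    rw [inv_inv, hB'sum]
    exact h.sum_mem _ _ fun i _ => h.smul_mem _ (hP i).1 _ (ht i)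
  · intro x hx i
    refine (hbound x hx i).trans (le_of_eq ?_)
    rw [← hfB, Matrix.mulVec_mulVec, ← Units.val_mul, mul_inv_cancel, Units.val_one,
      Matrix.one_mulVec]
  · intro A M hM hAM hAK i j
    rw [inv_inv]
    have hcol : (B' : Matrix m m ℝ).mulVec (Pi.single j 1) = (P : Matrix m m ℝ).row j := by
      rw [hB'sum, Finset.sum_eq_single j]
      · simp
      · intro k _ hk
        simp [hk]
      · simp
    -- An entry of the conjugate is a coordinate of the image under `A` of a frame vector. It is
    -- bounded by `f` of that image, and `f = 1` on the frame itself.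
    have hent : (((B'⁻¹ : Matrix.GeneralLinearGroup m ℝ) : Matrix m m ℝ) * A *
        (B' : Matrix m m ℝ)) i j = ((B'⁻¹ : Matrix.GeneralLinearGroup m ℝ) :
          Matrix m m ℝ).mulVec (A.mulVec ((P : Matrix m m ℝ).row j)) i := by
      rw [← hcol, Matrix.mulVec_mulVec, Matrix.mulVec_mulVec, Matrix.mulVec_single_one, mul_assoc]
      rfl
    rw [hent]
    refine (hbound _ (hAK _ (hP j).1) i).trans ((hfA A M hM hAM hAK _ (hP j).1).trans (le_of_eq ?_))
    rw [(hP j).2, mul_one]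

end RPn

/-! ### Hausdorff convergence in a compact space -/

/-- In a compact space, Kuratowski convergence of sets implies convergence in the Hausdorff
distance. -/
lemma Metric.tendsto_hausdorffEDist_of_compactSpace {X : Type*} [PseudoEMetricSpace X]
    [CompactSpace X] {A : ℕ → Set X} {B : Set X} (hB : IsClosed B)
    (h₁ : ∀ x ∈ B, ∀ U ∈ 𝓝 x, ∀ᶠ k in atTop, (A k ∩ U).Nonempty)
    (h₂ : ∀ (F : Ultrafilter ℕ), (F : Filter ℕ) ≤ atTop → ∀ (y : ℕ → X) (x : X),
      (∀ᶠ k in F, y k ∈ A k) → Tendsto y F (𝓝 x) → x ∈ B) :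
    Tendsto (fun k => Metric.hausdorffEDist (A k) B) atTop (𝓝 0) := by
  rw [ENNReal.tendsto_nhds_zero]
  intro ε hε
  by_contra hcon
  rw [Filter.not_eventually] at hcon
  have hne : (atTop ⊓ 𝓟 {k | ¬ Metric.hausdorffEDist (A k) B ≤ ε}).NeBot :=
    Filter.frequently_mem_iff_neBot.1 hcon
  let F : Ultrafilter ℕ := Ultrafilter.of (atTop ⊓ 𝓟 {k | ¬ Metric.hausdorffEDist (A k) B ≤ ε})
  have hF : (F : Filter ℕ) ≤ atTop ⊓ 𝓟 {k | ¬ Metric.hausdorffEDist (A k) B ≤ ε} :=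
    Ultrafilter.of_le _
  have hFtop : (F : Filter ℕ) ≤ atTop := hF.trans inf_le_left
  have hFev : ∀ᶠ k in F, ¬ Metric.hausdorffEDist (A k) B ≤ ε :=
    le_principal_iff.1 (hF.trans inf_le_right)
  -- The ultrafilter selects one of the two ways in which the distance can exceed `ε`; the offending
  -- points then converge by compactness.
  have hor : ∀ᶠ k in F, (∃ x ∈ A k, ε < Metric.infEDist x B) ∨
      (∃ x ∈ B, ε < Metric.infEDist x (A k)) := by
    filter_upwards [hFev] with k hk
    by_contra! hno
    exact hk (Metric.hausdorffEDist_le_of_infEDist hno.1 hno.2)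
  rcases Ultrafilter.eventually_or.1 hor with h | h
  · have hch : ∃ y : ℕ → X, ∀ᶠ k in F, y k ∈ A k ∧ ε < Metric.infEDist (y k) B := by
      obtain ⟨k₀, x₀, -⟩ := h.exists
      classical
      refine ⟨fun k => if hk : ∃ x ∈ A k, ε < Metric.infEDist x B then hk.choose else x₀, ?_⟩
      filter_upwards [h] with k hk
      rw [dif_pos hk]
      exact hk.choose_spec
    obtain ⟨y, hy⟩ := hch
    obtain ⟨x, -, hx⟩ := isCompact_univ.ultrafilter_le_nhds (F.map y) (by simp)
    have hx : Tendsto y F (𝓝 x) := hx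
    have hxB := h₂ F hFtop y x (hy.mono fun k hk => hk.1) hx
    have hlim : Tendsto (fun k => Metric.infEDist (y k) B) F (𝓝 (Metric.infEDist x B)) :=
      (Metric.continuous_infEDist.tendsto x).comp hx
    rw [Metric.infEDist_zero_of_mem hxB] at hlim
    exact hε.not_ge (ge_of_tendsto hlim (hy.mono fun k hk => hk.2.le))
  · have hch : ∃ y : ℕ → X, ∀ᶠ k in F, y k ∈ B ∧ ε < Metric.infEDist (y k) (A k) := by
      obtain ⟨k₀, x₀, -⟩ := h.exists
      classical
      refine ⟨fun k => if hk : ∃ x ∈ B, ε < Metric.infEDist x (A k) then hk.choose else x₀, ?_⟩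
      filter_upwards [h] with k hk
      rw [dif_pos hk]
      exact hk.choose_spec
    obtain ⟨y, hy⟩ := hch
    obtain ⟨x, -, hx⟩ := isCompact_univ.ultrafilter_le_nhds (F.map y) (by simp)
    have hx : Tendsto y F (𝓝 x) := hx
    have hxB : x ∈ B := hB.mem_of_tendsto hx (hy.mono fun k hk => hk.1)
    have hε2 : 0 < ε / 2 := ENNReal.half_pos hε.ne'
    have h3 := (h₁ x hxB _ (Metric.eball_mem_nhds x hε2)).filter_mono hFtop
    obtain ⟨k, ⟨z, hzA, hzx⟩, hyk, hyx⟩ := (h3.and (hy.and (hx (Metric.eball_mem_nhds x hε2)))).exists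
    refine hyk.2.not_ge ((Metric.infEDist_le_edist_of_mem hzA).trans ?_)
    refine (edist_triangle_right (y k) z x).trans ?_
    calc edist (y k) x + edist z x ≤ ε / 2 + ε / 2 :=
          add_le_add (le_of_lt (Metric.mem_eball.1 hyx)) (le_of_lt (Metric.mem_eball.1 hzx))
      _ = ε := ENNReal.add_halves ε

/-! ### Height functions of normalized cones -/

namespace RPn

section Height

variable {m : Type*} [Fintype m]

/-- `h x` is the largest `t` such that `x` minus the constant vector `t` lies in the closed convex
cone `{0 ≤ h}`, which contains the nonnegative orthant and lies in a fixed salient cone. -/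
structure IsHeight (h : (m → ℝ) → ℝ) : Prop where
  add_le : ∀ x y, h x + h y ≤ h (x + y)
  smul_le : ∀ c x, 0 ≤ c → c * h x ≤ h (c • x)
  add_const : ∀ x t, h (x + t • 1) = h x + t
  nonneg : ∀ x, (∀ i, 0 ≤ x i) → 0 ≤ h x
  abs_le : ∀ x i, |x i - h x| ≤ ∑ j, (x j - h x)

/-- The admissible `t` form a closed set, nonempty because `K` contains the orthant, and bounded
above by the mean of the coordinates because `habs` makes the coordinate sum nonnegative on `K`. The
supremum is therefore attained. -/
lemma exists_isHeight [Nonempty m] {K : Set (m → ℝ)} (hcl : IsClosed K)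
    (hadd : ∀ x ∈ K, ∀ y ∈ K, x + y ∈ K) (hsmul : ∀ x ∈ K, ∀ c : ℝ, 0 ≤ c → c • x ∈ K)
    (horth : ∀ x : m → ℝ, (∀ i, 0 ≤ x i) → x ∈ K) (habs : ∀ x ∈ K, ∀ i, |x i| ≤ ∑ j, x j) :
    ∃ h : (m → ℝ) → ℝ, IsHeight h ∧ ∀ x, x ∈ K ↔ 0 ≤ h x := by
  have hone : ∀ t : ℝ, 0 ≤ t → t • (1 : m → ℝ) ∈ K := fun t ht => horth _ fun i => by simpa using ht
  let S : (m → ℝ) → Set ℝ := fun x => {t | x - t • 1 ∈ K}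
  have hSne : ∀ x, (S x).Nonempty := fun x => ⟨-‖x‖, horth _ fun i => by
    have := neg_le_of_abs_le (norm_le_pi_norm x i)
    simp only [Pi.sub_apply, Pi.smul_apply, Pi.one_apply, smul_eq_mul]
    linarith⟩
  have hSbdd : ∀ x, BddAbove (S x) := fun x => by
    refine ⟨(∑ j, x j) / Fintype.card m, fun t ht => ?_⟩
    have hc : (0 : ℝ) < Fintype.card m := by exact_mod_cast Fintype.card_pos
    obtain ⟨i⟩ := ‹Nonempty m›
    have h1 := (abs_nonneg _).trans (habs _ ht i)
    simp only [Pi.sub_apply, Pi.smul_apply, Pi.one_apply, smul_eq_mul, mul_one,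
      Finset.sum_sub_distrib, Finset.sum_const, Finset.card_univ, nsmul_eq_mul] at h1
    rw [le_div_iff₀ hc]
    linarith
  have hScl : ∀ x, IsClosed (S x) := fun x => hcl.preimage (by fun_prop)
  have key : ∀ x t, t ≤ sSup (S x) ↔ x - t • 1 ∈ K := by
    refine fun x t => ⟨fun ht => ?_, fun ht => le_csSup (hSbdd x) ht⟩
    have h1 : x - sSup (S x) • 1 ∈ K := (hScl x).csSup_mem (hSne x) (hSbdd x)
    have h2 := hadd _ h1 _ (hone (sSup (S x) - t) (by linarith))
    convert h2 using 1
    module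
  have hself : ∀ x, x - sSup (S x) • 1 ∈ K := fun x => (key x _).1 le_rfl
  refine ⟨fun x => sSup (S x), ⟨fun x y => ?_, fun c x hc => ?_, fun x t => ?_, fun x hx => ?_,
    fun x i => ?_⟩, fun x => ?_⟩
  · rw [key]
    convert hadd _ (hself x) _ (hself y) using 1
    module
  · rw [key]
    convert hsmul _ (hself x) c hc using 1
    module
  · refine le_antisymm ?_ ?_
    · rw [← sub_le_iff_le_add, key]
      convert hself (x + t • 1) using 1
      module
    · rw [key]
      convert hself x using 1
      module
  · rw [key]
    simpa using horth x hx
  · simpa using habs _ (hself x) i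
  · rw [key]
    simp

variable {h : (m → ℝ) → ℝ}

lemma IsHeight.zero (hh : IsHeight h) : h 0 = 0 := by
  have h1 := hh.nonneg 0 fun i => le_rfl
  have h2 := hh.add_le 0 0
  rw [add_zero] at h2
  linarith

lemma IsHeight.smul (hh : IsHeight h) {c : ℝ} (hc : 0 < c) (x : m → ℝ) : h (c • x) = c * h x := by
  refine le_antisymm ?_ (hh.smul_le c x hc.le)
  have h1 := hh.smul_le c⁻¹ (c • x) (by positivity)
  rw [smul_smul, inv_mul_cancel₀ hc.ne', one_smul, inv_mul_le_iff₀ hc] at h1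
  exact h1

/-- The vector `y - x + ‖x - y‖ • 1` lies in the orthant; superadditivity does the rest. The
resulting Lipschitz constant is the same for all heights, which is the equicontinuity behind the
compactness argument. -/
lemma IsHeight.sub_le (hh : IsHeight h) (x y : m → ℝ) : h x - ‖x - y‖ ≤ h y := by
  have h1 := hh.nonneg (y - x + ‖x - y‖ • 1) fun i => by
    have := le_of_abs_le (norm_le_pi_norm (x - y) i)
    simp only [Pi.sub_apply, Pi.add_apply, Pi.smul_apply, Pi.one_apply, smul_eq_mul] at this ⊢
    linarith
  have h2 := hh.add_le x (y - x)
  rw [hh.add_const] at h1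
  rw [add_sub_cancel] at h2
  linarith

lemma IsHeight.dist_le (hh : IsHeight h) (x y : m → ℝ) : |h x - h y| ≤ ‖x - y‖ := by
  have h1 := hh.sub_le x y
  have h2 := hh.sub_le y x
  rw [norm_sub_rev] at h2
  rw [abs_sub_le_iff]
  constructor <;> linarith

lemma IsHeight.continuous (hh : IsHeight h) : Continuous h := by
  refine LipschitzWith.continuous (K := 1) (LipschitzWith.of_dist_le_mul fun x y => ?_)
  rw [Real.dist_eq, dist_eq_norm, NNReal.coe_one, one_mul]
  exact hh.dist_le x y

lemma IsHeight.abs_le_norm (hh : IsHeight h) (x : m → ℝ) : |h x| ≤ ‖x‖ := by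
  simpa [hh.zero] using hh.dist_le x 0

lemma IsHeight.neg_le (hh : IsHeight h) (x : m → ℝ) : h (-x) ≤ -h x := by
  have := hh.add_le x (-x)
  rw [add_neg_cancel, hh.zero] at this
  linarith

/-- Moving along minus the constant vector lowers the height at unit speed, so no point of height
zero is interior. -/
lemma IsHeight.interior_eq (hh : IsHeight h) : interior {x | 0 ≤ h x} = {x | 0 < h x} := by
  refine subset_antisymm (fun x hx => ?_) ?_
  · have hc : Tendsto (fun t : ℝ => x - t • (1 : m → ℝ)) (𝓝 0) (𝓝 x) := by
      have := (by fun_prop : Continuous fun t : ℝ => x - t • (1 : m → ℝ)).tendsto 0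
      simpa using this
    have hev : ∀ᶠ t in 𝓝[>] (0 : ℝ), x - t • (1 : m → ℝ) ∈ {x | 0 ≤ h x} :=
      hc.mono_left nhdsWithin_le_nhds (mem_interior_iff_mem_nhds.1 hx)
    obtain ⟨t, ht, htpos⟩ := (hev.and self_mem_nhdsWithin).exists
    have ht' : 0 ≤ h (x - t • 1) := ht
    have h1 := hh.add_const (x - t • 1) t
    rw [sub_add_cancel] at h1
    have : (0 : ℝ) < t := htpos
    change 0 < h x
    linarith
  · exact interior_maximal (fun x (hx : 0 < h x) => hx.le)
      (isOpen_lt continuous_const hh.continuous)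

/-- All the axioms are closed conditions. In particular the limit cone still contains the orthant
and lies in the same salient cone, so nothing degenerates. -/
lemma IsHeight.of_tendsto {ι : Type*} {F : Filter ι} [F.NeBot] {f : ι → (m → ℝ) → ℝ}
    (hf : ∀ k, IsHeight (f k)) (hlim : ∀ x, Tendsto (fun k => f k x) F (𝓝 (h x))) :
    IsHeight h where
  add_le x y := le_of_tendsto_of_tendsto' ((hlim x).add (hlim y)) (hlim (x + y))
    fun k => (hf k).add_le x y
  smul_le c x hc := le_of_tendsto_of_tendsto' ((hlim x).const_mul c) (hlim (c • x))
    fun k => (hf k).smul_le c x hc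
  add_const x t := tendsto_nhds_unique (hlim (x + t • 1))
    (((hlim x).add_const t).congr fun k => ((hf k).add_const x t).symm)
  nonneg x hx := ge_of_tendsto' (hlim x) fun k => (hf k).nonneg x hx
  abs_le x i := le_of_tendsto_of_tendsto' ((hlim x).const_sub (x i)).abs
    (tendsto_finsetSum _ fun j _ => (hlim x).const_sub (x j)) fun k => (hf k).abs_le x i

lemma IsHeight.tendsto_apply {ι : Type*} {F : Filter ι} {f : ι → (m → ℝ) → ℝ}
    (hf : ∀ k, IsHeight (f k)) (hlim : ∀ x, Tendsto (fun k => f k x) F (𝓝 (h x)))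
    {v : ι → m → ℝ} {w : m → ℝ} (hv : Tendsto v F (𝓝 w)) :
    Tendsto (fun k => f k (v k)) F (𝓝 (h w)) := by
  have h1 : Tendsto (fun k => f k (v k) - f k w) F (𝓝 0) := by
    rw [tendsto_zero_iff_abs_tendsto_zero]
    have h2 : Tendsto (fun k => ‖v k - w‖) F (𝓝 0) := tendsto_iff_norm_sub_tendsto_zero.1 hv
    exact squeeze_zero (fun k => abs_nonneg _) (fun k => (hf k).dist_le _ _) h2
  simpa using h1.add (hlim w)

/-- Convergence of height functions on a dense sequence implies pointwise convergence. -/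
lemma IsHeight.exists_tendsto {f : ℕ → (m → ℝ) → ℝ} (hf : ∀ k, IsHeight (f k))
    (hlim : ∀ j : ℕ, ∃ y, Tendsto (fun k => f k (TopologicalSpace.denseSeq (m → ℝ) j)) atTop (𝓝 y)) :
    ∃ g : (m → ℝ) → ℝ, ∀ x, Tendsto (fun k => f k x) atTop (𝓝 (g x)) := by
  have hx : ∀ x, ∃ y, Tendsto (fun k => f k x) atTop (𝓝 y) := by
    intro x
    refine cauchySeq_tendsto_of_complete (Metric.cauchySeq_iff'.2 fun ε hε => ?_)
    obtain ⟨_, ⟨j, rfl⟩, hj⟩ := Metric.mem_closure_iff.1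
      (TopologicalSpace.denseRange_denseSeq (m → ℝ) x) (ε / 3) (by positivity)
    obtain ⟨y, hy⟩ := hlim j
    obtain ⟨N, hN⟩ := Metric.cauchySeq_iff'.1 hy.cauchySeq (ε / 3) (by positivity)
    refine ⟨N, fun k hk => ?_⟩
    have h1 := hN k hk
    have h2 := (hf k).dist_le x (TopologicalSpace.denseSeq (m → ℝ) j)
    have h3 := (hf N).dist_le x (TopologicalSpace.denseSeq (m → ℝ) j)
    rw [dist_eq_norm] at hj
    rw [Real.dist_eq] at h1 ⊢
    rw [abs_lt] at h1 ⊢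
    rw [_root_.abs_le] at h2 h3
    constructor <;> linarith [h1.1, h1.2, h2.1, h2.2, h3.1, h3.2]
  choose g hg using hx
  exact ⟨g, hg⟩

end Height

/-! ### Subsets of projective space described by heights -/

variable {n : ℕ}

/-- The closure and the interior of `Ω` are the sets of lines through the points where the height
function `h` is nonnegative and positive. -/
structure IsHeightLift (Ω : Set (RPn n)) (h : (Fin (n + 1) → ℝ) → ℝ) : Prop extends IsHeight h where
  mem_lift_closure : ∀ v, v ≠ 0 → (v ∈ lift (closure Ω) ↔ 0 ≤ h v ∨ 0 ≤ h (-v))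
  mem_lift_interior : ∀ v, v ≠ 0 → (v ∈ lift (interior Ω) ↔ 0 < h v ∨ 0 < h (-v))

/-- The points of projective space represented by vectors at which `h` takes values in `Z`. -/
def ofHeight (h : (Fin (n + 1) → ℝ) → ℝ) (Z : Set ℝ) : Set (RPn n) :=
  {p | ∃ (v : Fin (n + 1) → ℝ) (hv : v ≠ 0), p = Projectivization.mk ℝ v hv ∧ h v ∈ Z}

lemma mem_ofHeight {h : (Fin (n + 1) → ℝ) → ℝ} (hh : IsHeight h) {Z : Set ℝ}
    (hZ : ∀ z ∈ Z, ∀ c : ℝ, 0 < c → c * z ∈ Z) {v : Fin (n + 1) → ℝ} (hv : v ≠ 0) :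
    Projectivization.mk ℝ v hv ∈ ofHeight h Z ↔ h v ∈ Z ∨ h (-v) ∈ Z := by
  constructor
  · rintro ⟨w, hw, hvw, hwZ⟩
    obtain ⟨c, rfl⟩ := (Projectivization.mk_eq_mk_iff' ℝ _ _ _ _).1 hvw
    have hc : c ≠ 0 := by
      rintro rfl
      exact hv (zero_smul _ _)
    rcases lt_or_gt_of_ne hc with hc | hc
    · right
      rw [← neg_smul, hh.smul (by linarith)]
      exact hZ _ hwZ _ (by linarith)
    · left
      rw [hh.smul hc]
      exact hZ _ hwZ _ hc
  · rintro (h | h)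
    · exact ⟨v, hv, rfl, h⟩
    · refine ⟨-v, neg_ne_zero.2 hv, ?_, h⟩
      rw [Projectivization.mk_eq_mk_iff']
      exact ⟨-1, by simp⟩

lemma IsHeightLift.closure_eq {Ω : Set (RPn n)} {h : (Fin (n + 1) → ℝ) → ℝ}
    (hh : IsHeightLift Ω h) : closure Ω = ofHeight h (Set.Ici 0) := by
  ext p
  rw [← p.mk_rep, mem_ofHeight (Z := Set.Ici 0) hh.toIsHeight (fun z hz c hc => mul_nonneg hc.le hz),
    ← mem_lift p.rep_nonzero, hh.mem_lift_closure _ p.rep_nonzero]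
  rfl

/-- Superadditivity gives `h v + h (-v) ≤ 0`, so a vector of height zero has no opposite of positive
height: the boundary of one sheet avoids the interior of the other. -/
lemma IsHeightLift.frontier_eq {Ω : Set (RPn n)} {h : (Fin (n + 1) → ℝ) → ℝ}
    (hh : IsHeightLift Ω h) : frontier Ω = ofHeight h {0} := by
  ext p
  have h1 := hh.mem_lift_closure _ p.rep_nonzero
  have h2 := hh.mem_lift_interior _ p.rep_nonzero
  have h3 := hh.neg_le p.rep
  rw [mem_lift p.rep_nonzero] at h1 h2
  rw [← p.mk_rep, mem_ofHeight hh.toIsHeight (fun z hz c hc => by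
    rw [Set.mem_singleton_iff.1 hz, mul_zero]; rfl), frontier, Set.mem_sdiff, h1, h2]
  simp only [Set.mem_singleton_iff, not_or, not_lt]
  constructor
  · rintro ⟨h4 | h4, h5, h6⟩
    · exact Or.inl (le_antisymm h5 h4)
    · exact Or.inr (le_antisymm h6 h4)
  · rintro (h4 | h4)
    · exact ⟨Or.inl h4.ge, h4.le, by linarith⟩
    · exact ⟨Or.inr h4.ge, by linarith, h4.le⟩

/-- A vector `v` with `h v ∈ Z` is the limit of `v + (h v - f k v) • 1`, on which `f k` takes
exactly the value `h v`. Conversely, unit representatives converge along an ultrafilter, and their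
heights converge by the uniform Lipschitz bound. The cases `Z = Set.Ici 0` and `Z = {0}` give
closures and frontiers. -/
lemma tendsto_hausdorffEDist_ofHeight {f : ℕ → (Fin (n + 1) → ℝ) → ℝ}
    {h : (Fin (n + 1) → ℝ) → ℝ} (hf : ∀ k, IsHeight (f k))
    (hlim : ∀ x, Tendsto (fun k => f k x) atTop (𝓝 (h x))) {Z : Set ℝ} (hZ : IsClosed Z)
    (hZs : ∀ z ∈ Z, ∀ c : ℝ, 0 < c → c * z ∈ Z) (hcl : IsClosed (ofHeight h Z)) :
    Tendsto (fun k => Metric.hausdorffEDist (ofHeight (f k) Z) (ofHeight h Z)) atTop (𝓝 0) := by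
  refine Metric.tendsto_hausdorffEDist_of_compactSpace hcl ?_ ?_
  · rintro _ ⟨v, hv, rfl, hvZ⟩ U hU
    have h1 : Tendsto (fun k => v + (h v - f k v) • (1 : Fin (n + 1) → ℝ)) atTop (𝓝 v) := by
      have := (((hlim v).const_sub (h v)).smul_const (1 : Fin (n + 1) → ℝ)).const_add v
      simpa using this
    obtain ⟨T, hT, hTU⟩ := mem_nhds_subtype _ _ _ |>.1
      (continuous_mk'.tendsto (⟨v, hv⟩ : {v : Fin (n + 1) → ℝ // v ≠ 0}) hU)
    filter_upwards [h1.eventually_ne hv, h1 hT] with k hk hkT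
    refine ⟨Projectivization.mk ℝ _ hk, ⟨_, hk, rfl, ?_⟩, @hTU ⟨_, hk⟩ hkT⟩
    rw [(hf k).add_const, add_sub_cancel]
    exact hvZ
  · intro F hF y x hy hyx
    have hch : ∀ k, ∃ v : Fin (n + 1) → ℝ, y k ∈ ofHeight (f k) Z →
        ∃ hv : v ≠ 0, ‖v‖ = 1 ∧ y k = Projectivization.mk ℝ v hv ∧ f k v ∈ Z := by
      intro k
      by_cases hk : y k ∈ ofHeight (f k) Z
      · obtain ⟨v, hv, hyv, hvZ⟩ := hk
        have hn := norm_pos_iff.2 hv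
        refine ⟨‖v‖⁻¹ • v, fun _ => ⟨smul_ne_zero (inv_ne_zero hn.ne') hv, ?_, ?_, ?_⟩⟩
        · rw [norm_smul, norm_inv, norm_norm, inv_mul_cancel₀ hn.ne']
        · rw [hyv, eq_comm, Projectivization.mk_eq_mk_iff']
          exact ⟨_, rfl⟩
        · rw [(hf k).smul (inv_pos.2 hn)]
          exact hZs _ hvZ _ (inv_pos.2 hn)
      · exact ⟨0, fun h => absurd h hk⟩
    choose v hv using hch
    obtain ⟨w, hw, hvw⟩ := (isCompact_sphere (0 : Fin (n + 1) → ℝ) 1).ultrafilter_le_nhds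
      (F.map v) (by
        rw [le_principal_iff]
        refine Ultrafilter.mem_map.2 ?_
        filter_upwards [hy] with k hk
        obtain ⟨_, h1, -⟩ := hv k hk
        exact mem_sphere_zero_iff_norm.2 h1)
    have hvw : Tendsto v F (𝓝 w) := hvw
    have hw0 : w ≠ 0 := norm_ne_zero_iff.1 (by rw [mem_sphere_zero_iff_norm.1 hw]; simp)
    have hhw : h w ∈ Z := by
      refine hZ.mem_of_tendsto (IsHeight.tendsto_apply hf (fun x => (hlim x).mono_left hF) hvw) ?_
      filter_upwards [hy] with k hk
      exact (hv k hk).2.2.2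
    have hyw : Tendsto y F (𝓝 (Projectivization.mk ℝ w hw0)) := by
      refine fun U hU => ?_
      obtain ⟨T, hT, hTU⟩ := mem_nhds_subtype _ _ _ |>.1
        (continuous_mk'.tendsto (⟨w, hw0⟩ : {v : Fin (n + 1) → ℝ // v ≠ 0}) hU)
      rw [mem_map]
      have hvT : ∀ᶠ k in F, v k ∈ T := hvw hT
      filter_upwards [hy, hvT] with k hk hkT
      obtain ⟨h1, -, h2, -⟩ := hv k hk
      have := @hTU ⟨v k, h1⟩ hkT
      rw [Set.mem_preimage, h2]
      exact this
    rw [tendsto_nhds_unique hyx hyw]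
    exact ⟨w, hw0, rfl, hhw⟩

lemma tendsto_hausdorffBoundaryEDist {Ω : ℕ → Set (RPn n)} {Ω' : Set (RPn n)}
    {f : ℕ → (Fin (n + 1) → ℝ) → ℝ} {h : (Fin (n + 1) → ℝ) → ℝ}
    (hf : ∀ k, IsHeightLift (Ω k) (f k)) (hh : IsHeightLift Ω' h)
    (hlim : ∀ x, Tendsto (fun k => f k x) atTop (𝓝 (h x))) :
    Tendsto (fun k => hausdorffBoundaryEDist (Ω k) Ω') atTop (𝓝 0) := by
  have h1 := tendsto_hausdorffEDist_ofHeight (fun k => (hf k).toIsHeight) hlim isClosed_Ici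
    (fun z hz c hc => mul_nonneg hc.le hz) (hh.closure_eq ▸ isClosed_closure)
  have h2 := tendsto_hausdorffEDist_ofHeight (fun k => (hf k).toIsHeight) hlim
    (isClosed_singleton (x := (0 : ℝ))) (fun z hz c hc => by
      rw [Set.mem_singleton_iff.1 hz, mul_zero]; rfl) (hh.frontier_eq ▸ isClosed_frontier)
  have h3 := h1.max h2
  rw [max_self] at h3
  refine h3.congr fun k => ?_
  rw [← (hf k).closure_eq, ← (hf k).frontier_eq, ← hh.closure_eq, ← hh.frontier_eq,
    Metric.hausdorffEDist_closure]
  rfl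

lemma mem_lift_ofHeight_Ioi {h : (Fin (n + 1) → ℝ) → ℝ} (hh : IsHeight h)
    {v : Fin (n + 1) → ℝ} (hv : v ≠ 0) :
    v ∈ lift (ofHeight h (Set.Ioi 0)) ↔ 0 < h v ∨ 0 < h (-v) := by
  rw [mem_lift hv, mem_ofHeight (Z := Set.Ioi 0) hh (fun z hz c hc => mul_pos hc hz)]
  rfl

lemma IsHeight.lift_ofHeight_Ioi {h : (Fin (n + 1) → ℝ) → ℝ} (hh : IsHeight h) :
    lift (ofHeight h (Set.Ioi 0)) = {v | 0 < h v} ∪ {v | 0 < h (-v)} := by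
  ext v
  rcases eq_or_ne v 0 with rfl | hv
  · simp [lift, hh.zero]
  · exact mem_lift_ofHeight_Ioi hh hv

lemma IsHeight.isOpen_ofHeight_Ioi {h : (Fin (n + 1) → ℝ) → ℝ} (hh : IsHeight h) :
    IsOpen (ofHeight h (Set.Ioi 0)) := by
  rw [← interior_eq_iff_isOpen]
  have h1 : IsOpen (lift (ofHeight h (Set.Ioi 0))) := by
    rw [hh.lift_ofHeight_Ioi]
    exact (isOpen_lt continuous_const hh.continuous).union
      (isOpen_lt continuous_const (hh.continuous.comp continuous_neg))
  have h2 := interior_lift (ofHeight h (Set.Ioi 0))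
  rw [h1.interior_eq] at h2
  ext p
  rw [← p.mk_rep, ← mem_lift p.rep_nonzero, ← mem_lift p.rep_nonzero, h2]

lemma IsHeight.isHeightLift_ofHeight {h : (Fin (n + 1) → ℝ) → ℝ} (hh : IsHeight h) :
    IsHeightLift (ofHeight h (Set.Ioi 0)) h where
  toIsHeight := hh
  mem_lift_interior v hv := by
    rw [hh.isOpen_ofHeight_Ioi.interior_eq, mem_lift_ofHeight_Ioi hh hv]
  mem_lift_closure v hv := by
    rw [← mem_closure_lift hv]
    constructor
    · intro hmem
      have hcl : IsClosed ({v | 0 ≤ h v} ∪ {v | 0 ≤ h (-v)}) :=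
        (isClosed_le continuous_const hh.continuous).union
          (isClosed_le continuous_const (hh.continuous.comp continuous_neg))
      refine closure_minimal ?_ hcl hmem
      rw [hh.lift_ofHeight_Ioi]
      exact Set.union_subset_union (fun v (hv : 0 < h v) => hv.le)
        (fun v (hv : 0 < h (-v)) => hv.le)
    · have key : ∀ (w : Fin (n + 1) → ℝ), 0 ≤ h w →
          w ∈ closure {v : Fin (n + 1) → ℝ | 0 < h v} := by
        intro w hw
        have hc : Tendsto (fun t : ℝ => w + t • (1 : Fin (n + 1) → ℝ)) (𝓝[>] 0) (𝓝 w) := by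
          have := (by fun_prop : Continuous fun t : ℝ => w + t • (1 : Fin (n + 1) → ℝ)).tendsto 0
          rw [zero_smul, add_zero] at this
          exact this.mono_left nhdsWithin_le_nhds
        refine mem_closure_of_tendsto hc ?_
        filter_upwards [self_mem_nhdsWithin] with t ht
        rw [hh.add_const]
        exact add_pos_of_nonneg_of_pos hw ht
      rw [hh.lift_ofHeight_Ioi, closure_union]
      rintro (h1 | h1)
      · exact Or.inl (key v h1)
      · right
        have := map_mem_closure continuous_neg (key (-v) h1)
          (t := {v : Fin (n + 1) → ℝ | 0 < h (-v)}) fun x (hx : 0 < h x) => by simpa using hx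
        simpa using this

lemma IsHeight.hasFullDim {h : (Fin (n + 1) → ℝ) → ℝ} (hh : IsHeight h) :
    HasFullDim (ofHeight h (Set.Ioi 0)) := by
  rw [HasFullDim, hh.isOpen_ofHeight_Ioi.interior_eq]
  refine ⟨Projectivization.mk ℝ (1 : Fin (n + 1) → ℝ) one_ne_zero, 1, one_ne_zero, rfl, ?_⟩
  have := hh.add_const 0 1
  rw [zero_add, one_smul, hh.zero, zero_add] at this
  rw [this]
  exact Set.mem_Ioi.2 (one_pos : (0 : ℝ) < 1)

/-- For the projective lines: a plane meets the hyperplane of zero coordinate sum in a nonzero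
vector. There `abs_le` reads `|y i - h y| ≤ -(n + 1) * h y`, so `0 ≤ h y` forces `h y = 0` and then
`y = 0`. Hence the closure misses this hyperplane. -/
lemma IsHeight.isProperlyConvex {h : (Fin (n + 1) → ℝ) → ℝ} (hh : IsHeight h) :
    IsProperlyConvex (ofHeight h (Set.Ioi 0)) := by
  constructor
  · rintro _ ⟨u, hu, rfl, hu'⟩ _ ⟨v, hv, rfl, hv'⟩
    refine ⟨u, v, hu, hv, rfl, rfl, ?_⟩
    rintro _ ⟨s, t, hne, hs, ht, rfl⟩
    refine ⟨_, hne, rfl, ?_⟩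
    have hu' : 0 < h u := hu'
    have hv' : 0 < h v := hv'
    have h1 := hh.add_le (s • u) (t • v)
    have h2 := hh.smul_le s u hs
    have h3 := hh.smul_le t v ht
    have h4 := mul_nonneg hs hu'.le
    have h5 := mul_nonneg ht hv'.le
    change 0 < h _
    rcases hs.lt_or_eq with hs | rfl
    · have := mul_pos hs hu'
      linarith
    · rcases ht.lt_or_eq with ht | rfl
      · have := mul_pos ht hv'
        linarith
      · simp at hne
  · intro W hW hsub
    let s : (Fin (n + 1) → ℝ) →ₗ[ℝ] ℝ := ∑ i, LinearMap.proj i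
    have hs : ∀ x, s x = ∑ i, x i := fun x => by simp [s]
    obtain ⟨x, hxW, hx0, hsx⟩ : ∃ x ∈ W, x ≠ 0 ∧ s x = 0 := by
      have hker : LinearMap.ker (s.domRestrict W) ≠ ⊥ := by
        refine LinearMap.ker_ne_bot_of_finrank_lt ?_
        rw [hW, Module.finrank_self]
        norm_num
      obtain ⟨y, hy, hy0⟩ := Submodule.exists_mem_ne_zero_of_ne_bot hker
      exact ⟨y, y.2, fun h => hy0 (Subtype.ext h), hy⟩
    have hmem : x ∈ lift (closure (ofHeight h (Set.Ioi 0))) := by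
      refine ⟨hx0, hsub ?_⟩
      change (Projectivization.mk ℝ x hx0).submodule ≤ W
      rw [Projectivization.submodule_mk, Submodule.span_singleton_le_iff_mem]
      exact hxW
    have key : ∀ y : Fin (n + 1) → ℝ, s y = 0 → 0 ≤ h y → y = 0 := by
      intro y hy hhy
      have h1 : ∀ i, |y i - h y| ≤ -(((n + 1 : ℕ) : ℝ) * h y) := by
        intro i
        have := hh.abs_le y i
        rw [Finset.sum_sub_distrib, ← hs y, hy, Finset.sum_const, Finset.card_univ,
          Fintype.card_fin, nsmul_eq_mul, zero_sub] at this
        exact this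
      have h2 : (0 : ℝ) < ((n + 1 : ℕ) : ℝ) := by positivity
      have h3 : h y = 0 := by
        have := (abs_nonneg _).trans (h1 0)
        nlinarith
      ext i
      have := h1 i
      rw [h3, mul_zero, neg_zero, sub_zero] at this
      exact abs_eq_zero.1 (le_antisymm this (abs_nonneg _))
    rcases (hh.isHeightLift_ofHeight.mem_lift_closure x hx0).1 hmem with h1 | h1
    · exact hx0 (key x hsx h1)
    · exact hx0 (neg_eq_zero.1 (key (-x) (by rw [map_neg, hsx, neg_zero]) h1))

end RPn

lemma Group.FG.countable {G : Type*} [Group G] [Group.FG G] : Countable G := by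
  obtain ⟨α, _, φ, hφ⟩ := Group.fg_iff_exists_freeGroup_hom_surjective_finite.1 ‹Group.FG G›
  exact hφ.countable

/-! ### Projective maps acting on cones and heights -/

namespace RPn

variable {n : ℕ}

lemma mulVec_mem_lift_iff (A : Matrix.GeneralLinearGroup (Fin (n + 1)) ℝ) {Ω : Set (RPn n)}
    {v : Fin (n + 1) → ℝ} (hv : v ≠ 0) :
    (A : Matrix (Fin (n + 1)) (Fin (n + 1)) ℝ).mulVec v ∈ lift ((.mk A : PGLR n) • Ω) ↔
      v ∈ lift Ω := by
  obtain ⟨h, hA⟩ := mk_smul_mk A hv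
  rw [mem_lift h, mem_lift hv, ← hA, Set.smul_mem_smul_set_iff]

lemma mem_lift_smul_iff (B : Matrix.GeneralLinearGroup (Fin (n + 1)) ℝ) {Ω : Set (RPn n)}
    {v : Fin (n + 1) → ℝ} (hv : v ≠ 0) :
    v ∈ lift ((.mk B : PGLR n) • Ω) ↔
      ((B⁻¹ : Matrix.GeneralLinearGroup (Fin (n + 1)) ℝ) :
        Matrix (Fin (n + 1)) (Fin (n + 1)) ℝ).mulVec v ∈ lift Ω := by
  have h := mulVec_mem_lift_iff B⁻¹ (Ω := (.mk B : PGLR n) • Ω) hv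
  rw [smul_smul, map_inv, inv_mul_cancel, one_smul] at h
  exact h.symm

/-- An invertible matrix as a homeomorphism of the space of vectors. -/
def mulVecHomeomorph (A : Matrix.GeneralLinearGroup (Fin (n + 1)) ℝ) :
    (Fin (n + 1) → ℝ) ≃ₜ (Fin (n + 1) → ℝ) where
  toFun v := (A : Matrix (Fin (n + 1)) (Fin (n + 1)) ℝ).mulVec v
  invFun v := ((A⁻¹ : Matrix.GeneralLinearGroup (Fin (n + 1)) ℝ) :
    Matrix (Fin (n + 1)) (Fin (n + 1)) ℝ).mulVec v
  left_inv v := by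
    beta_reduce
    rw [Matrix.mulVec_mulVec, ← Units.val_mul, inv_mul_cancel, Units.val_one, Matrix.one_mulVec]
  right_inv v := by
    beta_reduce
    rw [Matrix.mulVec_mulVec, ← Units.val_mul, mul_inv_cancel, Units.val_one, Matrix.one_mulVec]
  continuous_toFun := Continuous.matrix_mulVec continuous_const continuous_id
  continuous_invFun := Continuous.matrix_mulVec continuous_const continuous_id

lemma mulVecHomeomorph_apply (A : Matrix.GeneralLinearGroup (Fin (n + 1)) ℝ)
    (v : Fin (n + 1) → ℝ) :
    mulVecHomeomorph A v = (A : Matrix (Fin (n + 1)) (Fin (n + 1)) ℝ).mulVec v := rfl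

lemma mulVec_inv_mulVec (A : Matrix.GeneralLinearGroup (Fin (n + 1)) ℝ)
    (v : Fin (n + 1) → ℝ) :
    (A : Matrix (Fin (n + 1)) (Fin (n + 1)) ℝ).mulVec
      (((A⁻¹ : Matrix.GeneralLinearGroup (Fin (n + 1)) ℝ) :
        Matrix (Fin (n + 1)) (Fin (n + 1)) ℝ).mulVec v) = v :=
  (mulVecHomeomorph A).right_inv v

lemma inv_mulVec_mulVec (A : Matrix.GeneralLinearGroup (Fin (n + 1)) ℝ)
    (v : Fin (n + 1) → ℝ) :
    ((A⁻¹ : Matrix.GeneralLinearGroup (Fin (n + 1)) ℝ) :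
        Matrix (Fin (n + 1)) (Fin (n + 1)) ℝ).mulVec
      ((A : Matrix (Fin (n + 1)) (Fin (n + 1)) ℝ).mulVec v) = v :=
  (mulVecHomeomorph A).left_inv v

lemma mulVec_ne_zero (A : Matrix.GeneralLinearGroup (Fin (n + 1)) ℝ) {v : Fin (n + 1) → ℝ}
    (hv : v ≠ 0) : (A : Matrix (Fin (n + 1)) (Fin (n + 1)) ℝ).mulVec v ≠ 0 :=
  (mk_smul_mk A hv).1

/-- A projective map preserving `Ω` has a representative preserving a cone over `Ω`. -/
lemma IsConeLift.exists_sign {Ω : Set (RPn n)} {K : Set (Fin (n + 1) → ℝ)} (hK : IsConeLift Ω K)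
    {A : Matrix.GeneralLinearGroup (Fin (n + 1)) ℝ} (hA : (.mk A : PGLR n) • Ω = Ω) :
    ∃ c : ℝˣ, |(c : ℝ)| = 1 ∧
      ∀ x ∈ K, (A.scale c : Matrix (Fin (n + 1)) (Fin (n + 1)) ℝ).mulVec x ∈ K := by
  set M := (A : Matrix (Fin (n + 1)) (Fin (n + 1)) ℝ) with hM
  have hor : ∀ x ∈ K, M.mulVec x ∈ K ∨ -M.mulVec x ∈ K := by
    intro x hx
    rcases eq_or_ne x 0 with rfl | hx0
    · left
      rwa [Matrix.mulVec_zero]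
    rw [← hK.mem_lift_closure _ (mulVec_ne_zero A hx0), ← hA, closure_smul,
      mulVec_mem_lift_iff A hx0, hK.mem_lift_closure _ hx0]
    exact Or.inl hx
  -- If both signs occurred, a segment in `K` between the two witnesses would contain a point sent
  -- into `K ∩ -K`, that is, the origin. Salience forbids the origin on a segment between nonzero
  -- points of `K`.
  have halt : (∀ x ∈ K, M.mulVec x ∈ K) ∨ (∀ x ∈ K, -M.mulVec x ∈ K) := by
    by_contra! hcon
    obtain ⟨⟨x, hx, hx1⟩, y, hy, hy1⟩ := hcon
    have hx2 := (hor x hx).resolve_left hx1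
    have hy2 := (hor y hy).resolve_right hy1
    have hsub : _root_.segment ℝ x y ⊆ K := by
      rintro _ ⟨a, b, ha, hb, -, rfl⟩
      exact hK.add_mem _ (hK.smul_mem x hx a ha) _ (hK.smul_mem y hy b hb)
    have hc : Continuous fun z : Fin (n + 1) → ℝ => M.mulVec z :=
      Continuous.matrix_mulVec continuous_const continuous_id
    obtain ⟨z, hz, hz1, hz2⟩ := isPreconnected_closed_iff.1 (convex_segment x y).isPreconnected
      ((fun z => M.mulVec z) ⁻¹' K) ((fun z => -M.mulVec z) ⁻¹' K)
      (hK.isClosed.preimage hc) (hK.isClosed.preimage hc.neg)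
      (fun z hz => hor z (hsub hz))
      ⟨y, right_mem_segment ℝ x y, hy2⟩ ⟨x, left_mem_segment ℝ x y, hx2⟩
    have hMz : M.mulVec z = 0 := hK.salient _ hz1 hz2
    have hz0 : z = 0 := by
      by_contra h0
      exact mulVec_ne_zero A h0 hMz
    obtain ⟨a, b, ha, hb, hab, hzab⟩ := hz
    rw [hz0] at hzab
    have hax : a • x = 0 := by
      refine hK.salient _ (hK.smul_mem x hx a ha) ?_
      rw [neg_eq_of_add_eq_zero_right hzab]
      exact hK.smul_mem y hy b hb
    have hby : b • y = 0 := by rwa [hax, zero_add] at hzab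
    have hx0 : x ≠ 0 := by
      rintro rfl
      exact hx1 (by rwa [Matrix.mulVec_zero])
    have hy0 : y ≠ 0 := by
      rintro rfl
      exact hy1 (by rwa [Matrix.mulVec_zero, neg_zero])
    have ha0 := (smul_eq_zero.1 hax).resolve_right hx0
    have hb0 := (smul_eq_zero.1 hby).resolve_right hy0
    linarith
  rcases halt with h | h
  · refine ⟨1, by simp, fun x hx => ?_⟩
    rw [Matrix.GeneralLinearGroup.coe_scale, Units.val_one, one_smul]
    exact h x hx
  · refine ⟨-1, by simp, fun x hx => ?_⟩
    rw [Matrix.GeneralLinearGroup.coe_scale, Units.val_neg, Units.val_one, neg_one_smul,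
      Matrix.neg_mulVec]
    exact h x hx

/-- A properly convex set has a projective image that is described by a height function, and the
linear maps preserving its cone are bounded after the change of coordinates. -/
lemma IsConeLift.exists_isHeightLift {Ω : Set (RPn n)} {K : Set (Fin (n + 1) → ℝ)}
    (hK : IsConeLift Ω K) :
    ∃ (B : Matrix.GeneralLinearGroup (Fin (n + 1)) ℝ) (h : (Fin (n + 1) → ℝ) → ℝ),
      IsHeightLift ((.mk B : PGLR n) • Ω) h ∧
      ∀ (A : Matrix.GeneralLinearGroup (Fin (n + 1)) ℝ) (M : ℝ), 0 < M →
        (∀ i j, |A i j| ≤ M) →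
        (∀ x ∈ K, (A : Matrix (Fin (n + 1)) (Fin (n + 1)) ℝ).mulVec x ∈ K) →
        (∀ i j, |(B * A * B⁻¹) i j| ≤ (n + 1 : ℕ) ^ 2 * M) ∧
        ∀ x, 0 ≤ h x → 0 ≤ h (((B * A * B⁻¹ : Matrix.GeneralLinearGroup (Fin (n + 1)) ℝ) :
          Matrix (Fin (n + 1)) (Fin (n + 1)) ℝ).mulVec x) := by
  obtain ⟨B, horth, habs, hbound⟩ := hK.toIsSalientCone.exists_normalization
  obtain ⟨h, hh, hhK⟩ := exists_isHeight (K := mulVecHomeomorph B⁻¹ ⁻¹' K)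
    (hK.isClosed.preimage (mulVecHomeomorph B⁻¹).continuous)
    (fun x hx y hy => by
      rw [Set.mem_preimage, mulVecHomeomorph_apply, Matrix.mulVec_add]
      exact hK.add_mem _ hx _ hy)
    (fun x hx c hc => by
      rw [Set.mem_preimage, mulVecHomeomorph_apply, Matrix.mulVec_smul]
      exact hK.smul_mem _ hx c hc)
    (fun x hx => horth x hx)
    (fun x hx i => by
      have := habs _ hx i
      rwa [mulVecHomeomorph_apply, mulVec_inv_mulVec] at this)
  have hhK' : ∀ x, ((B⁻¹ : Matrix.GeneralLinearGroup (Fin (n + 1)) ℝ) :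
      Matrix (Fin (n + 1)) (Fin (n + 1)) ℝ).mulVec x ∈ K ↔ 0 ≤ h x := hhK
  have hint : ∀ x, ((B⁻¹ : Matrix.GeneralLinearGroup (Fin (n + 1)) ℝ) :
      Matrix (Fin (n + 1)) (Fin (n + 1)) ℝ).mulVec x ∈ interior K ↔ 0 < h x := by
    intro x
    have h1 : mulVecHomeomorph B⁻¹ ⁻¹' K = {x | 0 ≤ h x} := Set.ext hhK
    have h2 := (mulVecHomeomorph B⁻¹).preimage_interior K
    rw [h1, hh.interior_eq] at h2
    exact Set.ext_iff.1 h2 x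
  refine ⟨B, h, ⟨hh, fun v hv => ?_, fun v hv => ?_⟩, fun A M hM hAM hAK => ⟨fun i j => ?_, ?_⟩⟩
  · rw [closure_smul, mem_lift_smul_iff B hv, hK.mem_lift_closure _ (mulVec_ne_zero _ hv),
      ← Matrix.mulVec_neg, hhK', hhK']
  · rw [interior_smul, mem_lift_smul_iff B hv, hK.mem_lift_interior,
      ← Matrix.mulVec_neg, hint, hint]
  · have := hbound A M hM hAM hAK i j
    rw [Fintype.card_fin] at this
    exact this
  · intro x hx
    rw [← hhK'] at hx ⊢
    rw [Matrix.GeneralLinearGroup.coe_mul, Matrix.GeneralLinearGroup.coe_mul,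
      ← Matrix.mulVec_mulVec, ← Matrix.mulVec_mulVec, inv_mulVec_mulVec]
    exact hAK _ hx

/-- A limit of linear maps preserving the cones of convergent height functions preserves the
interior of the limit cone. -/
lemma IsHeight.pos_mulVec_of_tendsto {ι : Type*} {F : Filter ι} [F.NeBot]
    {f : ι → (Fin (n + 1) → ℝ) → ℝ} {h : (Fin (n + 1) → ℝ) → ℝ} (hf : ∀ k, IsHeight (f k))
    (hlim : ∀ x, Tendsto (fun k => f k x) F (𝓝 (h x)))
    {T : ι → Matrix.GeneralLinearGroup (Fin (n + 1)) ℝ}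
    {T' : Matrix.GeneralLinearGroup (Fin (n + 1)) ℝ} (hT : Tendsto T F (𝓝 T'))
    (hTf : ∀ k x, 0 ≤ f k x → 0 ≤ f k ((T k : Matrix (Fin (n + 1)) (Fin (n + 1)) ℝ).mulVec x))
    {x : Fin (n + 1) → ℝ} (hx : 0 < h x) :
    0 < h ((T' : Matrix (Fin (n + 1)) (Fin (n + 1)) ℝ).mulVec x) := by
  have hh : IsHeight h := IsHeight.of_tendsto hf hlim
  have hnonneg : ∀ y, 0 ≤ h y → 0 ≤ h ((T' : Matrix (Fin (n + 1)) (Fin (n + 1)) ℝ).mulVec y) := by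
    intro y hy
    -- The shift along the constant vector places the approximants in the cones of `f k`, where `T
    -- k` can be applied.
    have h1 : Tendsto (fun k => y + (h y - f k y) • (1 : Fin (n + 1) → ℝ)) F (𝓝 y) := by
      have := (((hlim y).const_sub (h y)).smul_const (1 : Fin (n + 1) → ℝ)).const_add y
      simpa using this
    have hc : Continuous fun p : Matrix (Fin (n + 1)) (Fin (n + 1)) ℝ × (Fin (n + 1) → ℝ) =>
        p.1.mulVec p.2 := Continuous.matrix_mulVec continuous_fst continuous_snd
    have h2 : Tendsto (fun k => ((T k : Matrix (Fin (n + 1)) (Fin (n + 1)) ℝ),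
        y + (h y - f k y) • (1 : Fin (n + 1) → ℝ))) F (𝓝 ((T' : Matrix _ _ ℝ), y)) :=
      (Matrix.GeneralLinearGroup.tendsto_iff.1 hT).prodMk_nhds h1
    refine ge_of_tendsto' (IsHeight.tendsto_apply hf hlim ((hc.tendsto _).comp h2)) fun k => ?_
    refine hTf k _ ?_
    rw [(hf k).add_const, add_sub_cancel]
    exact hy
  -- The limit only gives the weak inequality. Strictness follows because the invertible `T'`
  -- carries the interior of the cone onto an open subset of the cone.
  have hmem : (T' : Matrix (Fin (n + 1)) (Fin (n + 1)) ℝ).mulVec x ∈ interior {y | 0 ≤ h y} := by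
    have h1 : (mulVecHomeomorph T') '' {y | 0 ≤ h y} ⊆ {y | 0 ≤ h y} := by
      rintro _ ⟨y, hy, rfl⟩
      exact hnonneg y hy
    have h2 := interior_mono h1
    rw [← (mulVecHomeomorph T').image_interior] at h2
    refine h2 ⟨x, ?_, rfl⟩
    rw [hh.interior_eq]
    exact hx
  rwa [hh.interior_eq] at hmem

end RPn

/-! ### Extraction of the limit -/

/-- The inclusion for `g⁻¹` is the reverse inclusion for `g`. -/
lemma PRep.preserves_of_subset {G : Type*} [Group G] {n : ℕ} {σ : PRep G n} {Ω : Set (RPn n)}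
    (h : ∀ g, σ g • Ω ⊆ Ω) : σ.Preserves Ω := by
  intro g
  refine subset_antisymm (h g) ?_
  have := Set.smul_set_mono (a := σ g) (h g⁻¹)
  rwa [smul_smul, map_inv, mul_inv_cancel, one_smul] at this

lemma Real.exists_tendsto_subseq_of_abs_le {ι : Type*} [Countable ι] {x : ℕ → ι → ℝ} {C : ι → ℝ}
    (hx : ∀ k i, |x k i| ≤ C i) : ∃ (y : ι → ℝ) (φ : ℕ → ℕ), StrictMono φ ∧
      ∀ i, Tendsto (fun k => x (φ k) i) atTop (𝓝 (y i)) := by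
  obtain ⟨y, -, φ, hφ, hlim⟩ := (isCompact_univ_pi fun i =>
    isCompact_Icc (a := -C i) (b := C i)).tendsto_subseq (x := x)
    fun k i _ => abs_le.1 (hx k i)
  exact ⟨y, φ, hφ, tendsto_pi_nhds.1 hlim⟩

lemma Matrix.GeneralLinearGroup.exists_abs_le_of_tendsto {m : Type*} [Fintype m] [DecidableEq m]
    {A : ℕ → Matrix.GeneralLinearGroup m ℝ} {B : Matrix.GeneralLinearGroup m ℝ}
    (h : Tendsto A atTop (𝓝 B)) : ∃ M : ℝ, 0 < M ∧ ∀ k i j, |A k i j| ≤ M := by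
  have h1 : Tendsto (fun k => ∑ i, ∑ j, |A k i j|) atTop (𝓝 (∑ i, ∑ j, |B i j|)) :=
    tendsto_finsetSum _ fun i _ => tendsto_finsetSum _ fun j _ =>
      (Matrix.GeneralLinearGroup.tendsto_iff_entry.1 h i j).abs
  obtain ⟨M, hM⟩ := h1.bddAbove_range
  refine ⟨max M 1, by positivity, fun k i j => le_max_of_le_left ?_⟩
  refine le_trans ?_ (hM ⟨k, rfl⟩)
  refine le_trans ?_ (Finset.single_le_sum (f := fun i => ∑ j, |A k i j|)
    (fun i _ => Finset.sum_nonneg fun j _ => abs_nonneg _) (Finset.mem_univ i))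
  exact Finset.single_le_sum (f := fun j => |A k i j|) (fun j _ => abs_nonneg _) (Finset.mem_univ j)

theorem mainTheorem5 {G : Type*} [Group G] [Group.FG G] (n : ℕ)
    (ρ : ℕ → PRep G n) (ρlim : PRep G n) (Ω : ℕ → Set (RPn n))
    (hconvex : ∀ k, RPn.IsProperlyConvex (Ω k))
    (hdim : ∀ k, RPn.HasFullDim (Ω k))
    (hpres : ∀ k, (ρ k).Preserves (Ω k))
    (hlim : Tendsto ρ atTop (𝓝 ρlim)) :
    ∃ φ : ℕ → ℕ, StrictMono φ ∧
      ∃ (β : ℕ → PGLR n) (σ : PRep G n) (Ωlim : Set (RPn n)),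
        Tendsto (fun k => PRep.conj (β k) (ρ (φ k))) atTop (𝓝 σ) ∧
        IsOpen Ωlim ∧ RPn.IsProperlyConvex Ωlim ∧ RPn.HasFullDim Ωlim ∧
        Tendsto (fun k => RPn.hausdorffBoundaryEDist (β k • Ω (φ k)) Ωlim) atTop (𝓝 0) ∧
        σ.Preserves Ωlim ∧
        PRep.χ σ = PRep.χ ρlim := by
  have : Countable G := Group.FG.countable
  choose K hK using fun k => (hconvex k).exists_isConeLift (hdim k)
  choose B f hf hBf using fun k => (hK k).exists_isHeightLift
  choose A' hA' using fun g => Matrix.ProjGenLinGroup.mk_surjective (ρlim g)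
  have hlift := fun g => PGLR.exists_lift_tendsto (A := A' g)
    ((hA' g).symm ▸ PRep.tendsto_iff.1 hlim g)
  choose A hA hAlim using hlift
  choose M hM hAM using fun g => Matrix.GeneralLinearGroup.exists_abs_le_of_tendsto (hAlim g)
  -- Only a sign is spent on making the lifts preserve the cones, so the bounds `M g` on their
  -- entries survive.
  choose c hc hcK using fun g k => (hK k).exists_sign (A := A g k) (by rw [hA]; exact hpres k g)
  let T : ℕ → G → Matrix.GeneralLinearGroup (Fin (n + 1)) ℝ := fun k g =>
    B k * (A g k).scale (c g k) * (B k)⁻¹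
  have hTmk : ∀ k g, (.mk (T k g) : PGLR n) = PRep.conj (.mk (B k)) (ρ k) g := fun k g => by
    simp only [T, map_mul, map_inv, PGLR.mk_scale, hA, PRep.conj_apply]
  have hT : ∀ k g, (∀ i j, |T k g i j| ≤ (n + 1 : ℕ) ^ 2 * M g) ∧
      ∀ x, 0 ≤ f k x → 0 ≤ f k ((T k g : Matrix (Fin (n + 1)) (Fin (n + 1)) ℝ).mulVec x) :=
    fun k g => hBf k _ (M g) (hM g) (fun i j => by
      rw [Matrix.GeneralLinearGroup.coe_scale, Matrix.smul_apply, smul_eq_mul, abs_mul, hc, one_mul]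
      exact hAM g k i j) (hcK g k)
  -- A single extraction over a countable index set treats all matrix entries for all `g` together
  -- with the heights at a dense sequence.
  obtain ⟨y, φ, hφ, hy⟩ := Real.exists_tendsto_subseq_of_abs_le
    (ι := (G × Fin (n + 1) × Fin (n + 1)) ⊕ ℕ)
    (x := fun k => Sum.elim (fun p => T k p.1 p.2.1 p.2.2)
      (fun j => f k (TopologicalSpace.denseSeq _ j)))
    (C := Sum.elim (fun p => (n + 1 : ℕ) ^ 2 * M p.1)
      (fun j => ‖TopologicalSpace.denseSeq (Fin (n + 1) → ℝ) j‖))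
    (by
      rintro k (p | j)
      · exact (hT k p.1).1 _ _
      · exact (hf k).abs_le_norm _)
  obtain ⟨h, hh⟩ := RPn.IsHeight.exists_tendsto (f := fun k => f (φ k))
    (fun k => (hf (φ k)).toIsHeight) fun j => ⟨_, hy (Sum.inr j)⟩
  have hheight : RPn.IsHeight h := .of_tendsto (fun k => (hf (φ k)).toIsHeight) hh
  have hTlim : ∀ g, ∃ T' : Matrix.GeneralLinearGroup (Fin (n + 1)) ℝ,
      Tendsto (fun k => T (φ k) g) atTop (𝓝 T') := by
    intro g
    let Y : Matrix (Fin (n + 1)) (Fin (n + 1)) ℝ := Matrix.of fun i j => y (Sum.inl (g, i, j))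
    have h1 : Tendsto (fun k => (T (φ k) g : Matrix (Fin (n + 1)) (Fin (n + 1)) ℝ)) atTop (𝓝 Y) :=
      tendsto_pi_nhds.2 fun i => tendsto_pi_nhds.2 fun j => hy (Sum.inl (g, i, j))
    have h2 := (((continuous_id.matrix_det).tendsto _).comp h1).abs
    have h3 := ((((continuous_id.matrix_det).tendsto _).comp
      (Matrix.GeneralLinearGroup.tendsto_iff.1 (hAlim g))).abs).comp hφ.tendsto_atTop
    -- The signs `c g k` may change the determinant of the lift, so only absolute values are
    -- compared.
    have hdet : |Y.det| = |(A' g : Matrix (Fin (n + 1)) (Fin (n + 1)) ℝ).det| := by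
      refine tendsto_nhds_unique h2 (h3.congr fun k => ?_)
      simp only [Function.comp, id, T, Matrix.GeneralLinearGroup.coe_mul, Matrix.det_units_conj,
        Matrix.GeneralLinearGroup.coe_scale, Matrix.det_smul, abs_mul, abs_pow, hc, one_pow,
        one_mul]
    have hunit : IsUnit Y.det := by
      rw [isUnit_iff_ne_zero, ← abs_pos, hdet, abs_pos]
      exact ((A' g).isUnit.map Matrix.detMonoidHom).ne_zero
    exact ⟨Matrix.nonsingInvUnit Y hunit, Matrix.GeneralLinearGroup.tendsto_iff.2 h1⟩
  choose T' hT' using hTlim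
  obtain ⟨σ, hσ, hσlim⟩ := PRep.exists_tendsto
    (ρ := fun k => PRep.conj (.mk (B (φ k))) (ρ (φ k))) (t := fun g => .mk (T' g)) fun g =>
      ((PGLR.continuous_mk.tendsto _).comp (hT' g)).congr fun k => hTmk (φ k) g
  refine ⟨φ, hφ, fun k => .mk (B (φ k)), σ, RPn.ofHeight h (Set.Ioi 0), hσlim,
    hheight.isOpen_ofHeight_Ioi, hheight.isProperlyConvex, hheight.hasFullDim,
    RPn.tendsto_hausdorffBoundaryEDist (fun k => hf (φ k)) hheight.isHeightLift_ofHeight hh, ?_,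
    PRep.χ_eq_of_tendsto (hlim.comp hφ.tendsto_atTop) hσlim⟩
  refine PRep.preserves_of_subset fun g => ?_
  rw [hσ]
  rintro _ ⟨_, ⟨v, hv, rfl, hvpos⟩, rfl⟩
  obtain ⟨hne, hmk⟩ := RPn.mk_smul_mk (T' g) hv
  exact ⟨_, hne, hmk, RPn.IsHeight.pos_mulVec_of_tendsto (fun k => (hf (φ k)).toIsHeight) hh
    (hT' g) (fun k => (hT (φ k) g).2) hvpos⟩
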